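/- **Setting.** For $n\in\mathbb Z$ let $\mathcal D_n=\{[k2^{-n},(k+1)2^{-n}) : k\in\mathbb Z\}$ and $\mathcal D=\bigcup_n\mathcal D_n$. For $\delta\in\mathbb R$ let $\mathcal D^\delta=\bigcup_{n\in\mathbb Z}\mathcal D^\delta_n$, where $\mathcal D^\delta_n=\{I+\delta: I\in\mathcal D_n\}$ for $n\ge 0$, $\mathcal D^\delta_n=\{I+\delta+\sum_{j=n/2+1}^{0}2^{-2j} : I\in\mathcal D_n\}$ for even $n<0$, and for odd $n<0$ the collection $\mathcal D_n^\delta$ consists of the left and right halves of the intervals of $\mathcal D^\delta_{n-1}$. Put $$d(\delta)=\inf\{2^n|\delta-k2^{-n}| : n\in\mathbb Z,\ n\ge 0,\ k\in\mathbb Z\}.$$ Let $\omega$ be a nonnegative locally integrable function on $\mathbb R$ (a weight). Write $\omega(E)=\int_E\omega$ and $\langle f\rangle_Q=\frac1{|Q|}\int_Q f$. Intervals are bounded and nondegenerate. * The doubling constant of $\omega$ is the least $C\in[0,\infty]$ with $\omega(\widetilde Q)\le C\,\omega(Q)$ for all intervals $Q$, where $\widetilde Q$ has the same midpoint as $Q$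 and twice its length. For $\mathcal G\in\{\mathcal D,\mathcal D^\delta\}$ the dyadic doubling constant with respect to $\mathcal G$ is the least $C\in[0,\infty]$ with $\omega(\widetilde I)\le C\,\omega(I)$ for all $I\in\mathcal G$, where $\widetilde I\in\mathcal G$ is the dyadic parent of $I$. The weight is (dyadic) doubling if this constant is finite. * $A_p(\omega)$ is the supremum over all intervals $Q$ of $\langle\omega\rangle_Q\,\langle\omega^{-1/(p-1)}\rangle_Q^{\,p-1}$ if $1<p<\infty$, of $\langle\omega\rangle_Q\,(\operatorname{ess\,inf}_Q\omega)^{-1}$ if $p=1$, and of $\langle\omega\rangle_Q\exp\langle\log(1/\omega)\rangle_Q$ if $p=\infty$. $A_p^d(\omega)$ and $A_p^\delta(\omega)$ are the suprema of the same quantities over $Q\in\mathcal D$ and over $Q\in\mathcal D^\delta$. The classes $A_p$, $A_p^d$, $A_p^\delta$ consist of the weights for which the respective constant is finite. * $RH_p(\omega)$ is the supremum over all intervals $Q$ of $\langle\omega^p\rangle_Q^{1/p}\,\langle\omega\rangle_Q^{-1}$ if $1<p<\infty$, of $\big\langle\frac{\omega}{\langle\omega\rangle_Q}\log\frac{\omega}{\langle\omega\rangle_Q}\big\rangle_Q$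 if $p=1$, and of $(\operatorname{ess\,sup}_Q\omega)\,\langle\omega\rangle_Q^{-1}$ if $p=\infty$; $RH_p$ is the class of weights with $RH_p(\omega)<\infty$. $RH_p^d(\omega)$ (respectively $RH_p^\delta(\omega)$) is the larger of the supremum of the same quantity over $Q\in\mathcal D$ (respectively $Q\in\mathcal D^\delta$) and the dyadic doubling constant of $\omega$ with respect to that grid. The class $RH_p^d$ (respectively $RH_p^\delta$) consists of the weights for which this supremum is finite and which are dyadic doubling with respect to that grid. Here $0\cdot\infty=0$, $1/0=\infty$, $\log(1/0)=\infty$, $0\log 0=0$, and the $RH_p$ quantity is $0$ on an interval where $\omega=0$ a.e. **Theorem.** Let $\delta\in\mathbb R$ with $d(\delta)>0$. Then: (a) $\omega$ is doubling if and only if it is dyadic doubling with respect to both $\mathcal D$ and $\mathcal D^\delta$. (b) $A_p=A_p^d\cap A_p^\delta$ for $1\le p\le\infty$. (c) $RH_p=RH_p^d\cap RH_p^\delta$ for $1\le p\le\infty$. For fixed $\delta$ and $p$ the constants depend only on each other: the doubling constant is bounded by a function of the two dyadic doubling constants alone, and each of these by a function of the doubling constant alone; in the same sense $A_p(\omega)$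 and the pair $A_p^d(\omega),A_p^\delta(\omega)$ depend only on each other, and so do $RH_p(\omega)$ and the pair $RH_p^d(\omega),RH_p^\delta(\omega)$, for every $1\le p\le\infty$. Moreover, there is a constant $C=C(\delta)\ge1$, depending only on $\delta$, such that for every weight $\omega$, with $C_{\mathrm{dy}}$ the larger of its two dyadic doubling constants, * the doubling constant of $\omega$ is at most $C_{\mathrm{dy}}^{\log_2(2^3C)}$; * $A_p(\omega)\le C^p\max\{A_p^d(\omega),A_p^\delta(\omega)\}$ for $1\le p<\infty$; * $RH_p(\omega)\le C^{1/p}\,C_{\mathrm{dy}}^{\log_2(4C)}\max\{RH_p^d(\omega),RH_p^\delta(\omega)\}$ for $1<p<\infty$; * $RH_\infty(\omega)\le C_{\mathrm{dy}}^{\log_2(4C)}\max\{RH_\infty^d(\omega),RH_\infty^\delta(\omega)\}$. -/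

import Mathlib

open MeasureTheory Set
open scoped ENNReal NNReal

namespace DyadicWeights

noncomputable section

/-! ### Dyadic grids -/

/-- The relative distance from `δ` to the dyadic rationals,
`d(δ) = inf {2 ^ n * |δ - k / 2 ^ n| : n ≥ 0, k ∈ ℤ}`. -/
def relDist (δ : ℝ) : ℝ :=
  ⨅ q : ℕ × ℤ, (2 : ℝ) ^ q.1 * |δ - (q.2 : ℝ) / 2 ^ q.1|

/-- The `n`-th generation `𝒟_n` of the standard dyadic intervals `[k / 2 ^ n, (k + 1) / 2 ^ n)`. -/
def dyadicGrid (n : ℤ) : Set (Set ℝ) :=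
  {I | ∃ k : ℤ, I = Ico ((k : ℝ) / 2 ^ n) (((k : ℝ) + 1) / 2 ^ n)}

/-- The additional translation `∑_{j = ⌊n/2⌋ + 1}^{0} 2 ^ (-2 j)` of the large-scale intervals.
The sum is empty for `n ≥ 0`. Integer division rounds down here, so that an odd `n < 0` gets the
translation of the even number `n - 1`: the intervals of generation `n` are then the halves of the
intervals of generation `n - 1`, which is what nestedness forces. -/
def largeScaleShift (n : ℤ) : ℝ :=
  ∑ j ∈ Finset.Icc (n / 2 + 1) 0, (2 : ℝ) ^ (-2 * j)

/-- The `n`-th generation `𝒟^δ_n` of the translated dyadic intervals. -/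
def shiftedGrid (δ : ℝ) (n : ℤ) : Set (Set ℝ) :=
  {I | ∃ k : ℤ, I = Ico ((k : ℝ) / 2 ^ n + δ + largeScaleShift n)
    (((k : ℝ) + 1) / 2 ^ n + δ + largeScaleShift n)}

/-- All intervals of a grid given by its generations. -/
def gridIntervals (G : ℤ → Set (Set ℝ)) : Set (Set ℝ) := ⋃ n : ℤ, G n

/-- All bounded nondegenerate intervals of `ℝ`. End points carry no mass, so that half-open
intervals suffice. -/
def allIntervals : Set (Set ℝ) := {Q | ∃ a b : ℝ, a < b ∧ Q = Ico a b}

/-! ### Weights and averages -/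

/-- Nonnegative locally integrable functions on `ℝ`. -/
structure IsWeight (ω : ℝ → ℝ) : Prop where
  nonneg : ∀ x, 0 ≤ ω x
  locallyIntegrable : LocallyIntegrable ω volume

/-- `ω(E) = ∫_E ω`. -/
def mass (ω : ℝ → ℝ) (E : Set ℝ) : ℝ≥0∞ := ∫⁻ x in E, ENNReal.ofReal (ω x)

/-- The average over `Q` of a function with values in `[0, ∞]`. -/
def nonnegAvg (f : ℝ → ℝ≥0∞) (Q : Set ℝ) : ℝ≥0∞ := (∫⁻ x in Q, f x) / volume Q

/-- The average of `ω` over `Q`. -/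
def avg (ω : ℝ → ℝ) (Q : Set ℝ) : ℝ≥0∞ := nonnegAvg (fun x => ENNReal.ofReal (ω x)) Q

/-- The average over `Q` of an extended-real-valued function: the integral of the positive part
minus the integral of the negative part, divided by `|Q|`. -/
def extendedAvg (f : ℝ → EReal) (Q : Set ℝ) : EReal :=
  (((∫⁻ x in Q, (f x).toENNReal : ℝ≥0∞) : EReal) - ((∫⁻ x in Q, (-f x).toENNReal : ℝ≥0∞) : EReal))
    / ((volume.real Q : ℝ) : EReal)

/-! ### Doubling weights -/

/-- The doubling constant of `ω`: the least `C` with `ω(2Q) ≤ C ω(Q)` for all intervals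
`Q = [a, b)`, where `2Q` has the same midpoint as `Q` and twice its length (`∞` if there is no
finite `C`). -/
def doublingConst (ω : ℝ → ℝ) : ℝ≥0∞ :=
  sInf {C | ∀ a b : ℝ, a < b →
    mass ω (Ico (a - (b - a) / 2) (b + (b - a) / 2)) ≤ C * mass ω (Ico a b)}

/-- The dyadic doubling constant of `ω` with respect to the grid `G`: the least `C` with
`ω(J) ≤ C ω(I)` for every interval `I` of the grid, with parent `J`. -/
def dyadicDoublingConst (G : ℤ → Set (Set ℝ)) (ω : ℝ → ℝ) : ℝ≥0∞ :=
  sInf {C | ∀ n : ℤ, ∀ I ∈ G n, ∀ J ∈ G (n - 1), I ⊆ J → mass ω J ≤ C * mass ω I}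

/-- Doubling weights. -/
def IsDoubling (ω : ℝ → ℝ) : Prop := IsWeight ω ∧ doublingConst ω < ∞

/-- Dyadic doubling weights with respect to the grid `G`. -/
def IsDyadicDoubling (G : ℤ → Set (Set ℝ)) (ω : ℝ → ℝ) : Prop :=
  IsWeight ω ∧ dyadicDoublingConst G ω < ∞

/-! ### Muckenhoupt classes -/

open Classical in
/-- The quantity in the `A_p` condition on one interval, with the conventions `1 / 0 = ∞`,
`log (1 / 0) = ∞` and `0 * ∞ = 0`. -/
def apQuantity (p : ℝ≥0∞) (ω : ℝ → ℝ) (Q : Set ℝ) : ℝ≥0∞ :=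
  if p = 1 then
    avg ω Q * (essInf (fun x => ENNReal.ofReal (ω x)) (volume.restrict Q))⁻¹
  else if p = ∞ then
    avg ω Q * EReal.exp (extendedAvg (fun x => ENNReal.log (ENNReal.ofReal (ω x))⁻¹) Q)
  else
    avg ω Q *
      nonnegAvg (fun x => (ENNReal.ofReal (ω x))⁻¹ ^ (1 / (p.toReal - 1))) Q ^ (p.toReal - 1)

/-- The `A_p` constant of `ω` relative to a collection of intervals. -/
def apConst (𝓠 : Set (Set ℝ)) (p : ℝ≥0∞) (ω : ℝ → ℝ) : ℝ≥0∞ :=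
  ⨆ Q ∈ 𝓠, apQuantity p ω Q

/-- The class of `A_p` weights relative to a collection of intervals. -/
def apClass (𝓠 : Set (Set ℝ)) (p : ℝ≥0∞) : Set (ℝ → ℝ) :=
  {ω | IsWeight ω ∧ apConst 𝓠 p ω < ∞}

/-! ### Reverse Hölder classes -/

open Classical in
/-- The quantity in the `RH_p` condition on one interval. On an interval where `ω` vanishes almost
everywhere it is `0`. For `p = 1` the average is nonnegative, by Jensen's inequality. -/
def rhQuantity (p : ℝ≥0∞) (ω : ℝ → ℝ) (Q : Set ℝ) : ℝ≥0∞ :=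
  if p = 1 then
    (extendedAvg (fun x => ((ω x / (⨍ y in Q, ω y) * Real.log (ω x / (⨍ y in Q, ω y)) : ℝ) : EReal))
      Q).toENNReal
  else if p = ∞ then
    essSup (fun x => ENNReal.ofReal (ω x)) (volume.restrict Q) * (avg ω Q)⁻¹
  else
    nonnegAvg (fun x => ENNReal.ofReal (ω x) ^ p.toReal) Q ^ (1 / p.toReal) * (avg ω Q)⁻¹

/-- The supremum in the `RH_p` condition over a collection of intervals; over all intervals it is
the `RH_p` constant. -/
def rhConst (𝓠 : Set (Set ℝ)) (p : ℝ≥0∞) (ω : ℝ → ℝ) : ℝ≥0∞ :=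
  ⨆ Q ∈ 𝓠, rhQuantity p ω Q

/-- The class of `RH_p` weights. -/
def rhClass (p : ℝ≥0∞) : Set (ℝ → ℝ) :=
  {ω | IsWeight ω ∧ rhConst allIntervals p ω < ∞}

/-- The `RH_p` constant with respect to a grid: the larger of the supremum over the intervals of
the grid and the dyadic doubling constant. -/
def rhDyadicConst (G : ℤ → Set (Set ℝ)) (p : ℝ≥0∞) (ω : ℝ → ℝ) : ℝ≥0∞ :=
  max (rhConst (gridIntervals G) p ω) (dyadicDoublingConst G ω)

/-- The class of dyadic `RH_p` weights with respect to a grid; these are required to be dyadic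
doubling. -/
def rhDyadicClass (G : ℤ → Set (Set ℝ)) (p : ℝ≥0∞) : Set (ℝ → ℝ) :=
  {ω | IsWeight ω ∧ rhConst (gridIntervals G) p ω < ∞ ∧ IsDyadicDoubling G ω}

/-! ### Dependence of constants -/

/-- On weights, the constant `c` is bounded by a function of `c₁` and `c₂` only, and `c₁` and `c₂`
are bounded by a function of `c` only. -/
def DependOnlyOnEachOther (c c₁ c₂ : (ℝ → ℝ) → ℝ≥0∞) : Prop :=
  (∃ Φ : ℝ≥0 → ℝ≥0 → ℝ≥0, ∀ ω, IsWeight ω → ∀ K₁ K₂ : ℝ≥0,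
    c₁ ω ≤ K₁ → c₂ ω ≤ K₂ → c ω ≤ Φ K₁ K₂) ∧
  (∃ Ψ : ℝ≥0 → ℝ≥0, ∀ ω, IsWeight ω → ∀ K : ℝ≥0,
    c ω ≤ K → c₁ ω ≤ Ψ K ∧ c₂ ω ≤ Ψ K)

end

end DyadicWeights

open DyadicWeights

/-! The theorem rests on the one-third trick. In every generation the end points of `𝒟` and `𝒟^δ`
stay apart by a fixed proportion `c` of the cell length (`exists_separation`). At small scales this
is the hypothesis `d(δ) > 0`. At large scales the added translation is one or two thirds of the cell
length, up to a fixed error, so it cannot come close to a multiple of that length. An interval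
shorter than `c` times the cell length therefore cannot have end points of both grids in its
interior, and lies in one cell of one grid. Choosing the generation well makes the cell at most `C`
times as long (`exists_cover`).

It remains to compare an interval `Q` with its covering cell `I`. Averages of nonnegative functions
over `Q` are at most `C` times those over `I`, which settles `A_p` for `p < ∞`. For `A_∞` and `RH_1`
the integrand changes sign; its positive part is monotone in the interval, and its negative part is
controlled by `log t ≤ t` or `t log t ≥ -1`. Doubling and `RH_p` also need `ω(I)` bounded by a
multiple of `ω(Q)`: `Q` contains a cell boundedly many generations below `I`, and dyadic doubling
climbs back to `I` (`mass_cell_le_mul_mass`).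

In the converse direction the suprema over a grid are trivially bounded. What has to be proved is
that `RH_p` implies doubling: a small proportion of an interval carries at most half of its mass
(`exists_small_set_bound`), so enlarging an interval slightly at most doubles its mass, and
iteration gives any dilation.

Both grids are instances of one family with an arbitrary offset in each generation, so every
estimate is proved once. -/

namespace DyadicWeights

/-! ### Grids with an offset in each generation -/

/-- The `k`-th interval of generation `n` of the dyadic grid with offsets `s`. -/
def cell (s : ℤ → ℝ) (n k : ℤ) : Set ℝ :=
  Ico ((k : ℝ) / 2 ^ n + s n) (((k : ℝ) + 1) / 2 ^ n + s n)

/-- The dyadic grid translated by `s n` in generation `n`. -/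
def offsetGrid (s : ℤ → ℝ) (n : ℤ) : Set (Set ℝ) := {I | ∃ k : ℤ, I = cell s n k}

/-- Each generation of the grid refines the previous one. -/
def Nested (s : ℤ → ℝ) : Prop := ∀ n : ℤ, ∃ m : ℤ, s (n - 1) = s n + (m : ℝ) / 2 ^ n

theorem dyadicGrid_eq : dyadicGrid = offsetGrid (fun _ => 0) := by
  funext n
  simp [dyadicGrid, offsetGrid, cell]

theorem shiftedGrid_eq (δ : ℝ) :
    shiftedGrid δ = offsetGrid (fun n => δ + largeScaleShift n) := by
  funext n
  simp [shiftedGrid, offsetGrid, cell, add_assoc]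

theorem nested_zero : Nested (fun _ => 0) := fun n => ⟨0, by simp⟩

theorem cell_mem_allIntervals (s : ℤ → ℝ) (n k : ℤ) : cell s n k ∈ allIntervals := by
  refine ⟨_, _, ?_, rfl⟩
  have : (0 : ℝ) < 2 ^ n := by positivity
  gcongr
  linarith

theorem gridIntervals_offsetGrid_subset (s : ℤ → ℝ) :
    gridIntervals (offsetGrid s) ⊆ allIntervals := by
  intro I hI
  obtain ⟨n, k, rfl⟩ := mem_iUnion.1 hI
  exact cell_mem_allIntervals s n k

theorem cell_mem_gridIntervals (s : ℤ → ℝ) (n k : ℤ) :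
    cell s n k ∈ gridIntervals (offsetGrid s) :=
  mem_iUnion.2 ⟨n, k, rfl⟩

theorem volume_cell (s : ℤ → ℝ) (n k : ℤ) : volume (cell s n k) = ENNReal.ofReal (1 / 2 ^ n) := by
  rw [cell, Real.volume_Ico]
  congr 1
  ring

theorem eq_of_mem_cell {s : ℤ → ℝ} {n j k : ℤ} {x : ℝ} (hj : x ∈ cell s n j)
    (hk : x ∈ cell s n k) : j = k := by
  have h2 : (0 : ℝ) < 2 ^ n := by positivity
  have key : ∀ i : ℤ, x ∈ cell s n i → ⌊(x - s n) * 2 ^ n⌋ = i := by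
    rintro i ⟨h1, h3⟩
    rw [Int.floor_eq_iff]
    constructor
    · rw [← div_le_iff₀ h2]; linarith
    · rw [← lt_div_iff₀ h2]; linarith
  rw [← key j hj, ← key k hk]

theorem mem_cell_floor (s : ℤ → ℝ) (n : ℤ) (x : ℝ) : x ∈ cell s n ⌊(x - s n) * 2 ^ n⌋ := by
  have h2 : (0 : ℝ) < 2 ^ n := by positivity
  constructor
  · have := Int.floor_le ((x - s n) * 2 ^ n)
    rw [← div_le_iff₀ h2] at this
    linarith
  · have := Int.lt_floor_add_one ((x - s n) * 2 ^ n)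
    rw [← lt_div_iff₀ h2] at this
    linarith

theorem exists_parent {s : ℤ → ℝ} (hs : Nested s) (n k : ℤ) :
    ∃ j : ℤ, cell s n k ⊆ cell s (n - 1) j := by
  obtain ⟨m, hm⟩ := hs n
  have h2 : (0 : ℝ) < 2 ^ n := by positivity
  have h3 : (2 : ℝ) ^ (n - 1) = 2 ^ n / 2 := by
    rw [zpow_sub₀ two_ne_zero, zpow_one]
  -- In units of `1 / 2 ^ n` the coarse cell `j` covers the fine indices `2 j + m` and `2 j + m +
  -- 1`.
  refine ⟨(k - m) / 2, Ico_subset_Ico ?_ ?_⟩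
  · have h : (((k - m) / 2 : ℤ) : ℝ) * 2 ≤ (k : ℝ) - m := by
      have : (k - m) / 2 * 2 ≤ k - m := by omega
      exact_mod_cast this
    rw [hm, h3]
    have : (((k - m) / 2 : ℤ) : ℝ) / (2 ^ n / 2) = (((k - m) / 2 : ℤ) : ℝ) * 2 / 2 ^ n := by
      field_simp
    rw [this]
    have := div_le_div_of_nonneg_right h h2.le
    rw [sub_div] at this
    linarith
  · have h : (k : ℝ) + 1 - m ≤ ((((k - m) / 2 : ℤ) : ℝ) + 1) * 2 := by
      have : k + 1 - m ≤ ((k - m) / 2 + 1) * 2 := by omega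
      exact_mod_cast this
    rw [hm, h3]
    have : ((((k - m) / 2 : ℤ) : ℝ) + 1) / (2 ^ n / 2) =
        ((((k - m) / 2 : ℤ) : ℝ) + 1) * 2 / 2 ^ n := by
      field_simp
    rw [this]
    have := div_le_div_of_nonneg_right h h2.le
    rw [sub_div] at this
    linarith

/-- An interval contains a grid interval of each generation that is at most half as long. -/
theorem exists_cell_subset (s : ℤ → ℝ) {n : ℤ} {a b : ℝ} (h : 2 * (1 / 2 ^ n) ≤ b - a) :
    ∃ k : ℤ, cell s n k ⊆ Ico a b := by
  have h2 : (0 : ℝ) < 2 ^ n := by positivity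
  refine ⟨⌈(a - s n) * 2 ^ n⌉, Ico_subset_Ico ?_ ?_⟩
  · have := Int.le_ceil ((a - s n) * 2 ^ n)
    rw [← le_div_iff₀ h2] at this
    linarith
  · have := Int.ceil_lt_add_one ((a - s n) * 2 ^ n)
    have h4 : ((⌈(a - s n) * 2 ^ n⌉ : ℝ) + 1) / 2 ^ n ≤ ((a - s n) * 2 ^ n + 2) / 2 ^ n := by
      apply div_le_div_of_nonneg_right _ h2.le
      linarith
    have h5 : ((a - s n) * 2 ^ n + 2) / 2 ^ n = a - s n + 2 * (1 / 2 ^ n) := by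
      field_simp
    linarith

theorem exists_zpow_scale {L : ℝ} (hL : 0 < L) :
    ∃ n : ℤ, 1 / 2 ^ n ≤ L ∧ L < 2 * (1 / 2 ^ n) := by
  obtain ⟨n, h1, h2⟩ := exists_mem_Ico_zpow hL (one_lt_two (α := ℝ))
  refine ⟨-n, by simpa using h1, ?_⟩
  rw [zpow_add_one₀ two_ne_zero] at h2
  simpa [mul_comm] using h2

/-! ### The translated grid -/

theorem sum_Icc_four_zpow (m : ℕ) :
    ∑ j ∈ Finset.Icc (-(m : ℤ) + 1) 0, (2 : ℝ) ^ (-2 * j) = (4 ^ m - 1) / 3 := by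
  induction m with
  | zero => simp
  | succ m ih =>
    have h : Finset.Icc (-((m + 1 : ℕ) : ℤ) + 1) 0 =
        insert (-(m : ℤ)) (Finset.Icc (-(m : ℤ) + 1) 0) := by
      ext x
      simp only [Finset.mem_Icc, Finset.mem_insert]
      push_cast
      omega
    rw [h, Finset.sum_insert (by simp), ih]
    have : (2 : ℝ) ^ (-2 * -(m : ℤ)) = 4 ^ m := by
      rw [show -2 * -(m : ℤ) = ((2 * m : ℕ) : ℤ) by push_cast; ring, zpow_natCast, pow_mul]
      norm_num
    rw [this]
    ring

theorem largeScaleShift_of_nonneg {n : ℤ} (hn : 0 ≤ n) : largeScaleShift n = 0 := by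
  rw [largeScaleShift, Finset.Icc_eq_empty (by omega), Finset.sum_empty]

theorem largeScaleShift_even (m : ℕ) : largeScaleShift (-(2 * m : ℤ)) = (4 ^ m - 1) / 3 := by
  rw [largeScaleShift, ← sum_Icc_four_zpow m]
  congr 2
  omega

theorem largeScaleShift_odd (m : ℕ) : largeScaleShift (-(2 * m : ℤ) + 1) = (4 ^ m - 1) / 3 := by
  rw [largeScaleShift, ← sum_Icc_four_zpow m]
  congr 2
  omega

theorem two_zpow_neg_two_mul (m : ℕ) : (2 : ℝ) ^ (-(2 * m : ℤ)) = (4 ^ m)⁻¹ := by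
  rw [zpow_neg, zpow_mul]
  norm_num

theorem neg_cases (n : ℤ) :
    0 ≤ n ∨ ∃ m : ℕ, 1 ≤ m ∧ (n = -(2 * m : ℤ) ∨ n = -(2 * m : ℤ) + 1) := by
  rcases le_or_gt 0 n with h | h
  · exact .inl h
  · refine .inr ⟨((1 - n) / 2).toNat, ?_⟩
    omega

/-- The translation changes only from generation `-2 m` to `-2 m - 1`, and there by `4 ^ m`, exactly
one cell length of generation `-2 m`. -/
theorem nested_shift (δ : ℝ) : Nested (fun n => δ + largeScaleShift n) := by
  intro n
  dsimp only
  rcases neg_cases n with h | ⟨m, hm, rfl | rfl⟩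
  · rcases h.eq_or_lt with rfl | h
    · refine ⟨1, ?_⟩
      have h1 := largeScaleShift_odd 1
      norm_num at h1
      rw [largeScaleShift_of_nonneg le_rfl]
      norm_num [h1]
    · refine ⟨0, ?_⟩
      rw [largeScaleShift_of_nonneg h.le, largeScaleShift_of_nonneg (by omega)]
      simp
  · refine ⟨1, ?_⟩
    have h1 := largeScaleShift_odd (m + 1)
    rw [show -(2 * ((m + 1 : ℕ) : ℤ)) + 1 = -(2 * m : ℤ) - 1 by push_cast; ring] at h1
    rw [h1, largeScaleShift_even, two_zpow_neg_two_mul]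
    push_cast
    rw [one_div, inv_inv]
    ring
  · refine ⟨0, ?_⟩
    rw [largeScaleShift_odd, add_sub_cancel_right, largeScaleShift_even]
    simp

/-- By the geometric sum, the translation is one third (even generations) or two thirds (odd
generations) of the cell length, minus `1 / 3`. -/
theorem largeScaleShift_of_neg {n : ℤ} (hn : n ≤ 0) :
    ∃ θ : ℤ, (θ = 1 ∨ θ = 2) ∧ 3 * largeScaleShift n = θ * (1 / 2 ^ n) - 1 := by
  rcases neg_cases n with h | ⟨m, hm, rfl | rfl⟩
  · obtain rfl : n = 0 := le_antisymm hn h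
    exact ⟨1, by simp, by simp [largeScaleShift_of_nonneg]⟩
  · refine ⟨1, by simp, ?_⟩
    rw [largeScaleShift_even, two_zpow_neg_two_mul]
    simp
    ring
  · refine ⟨2, by simp, ?_⟩
    rw [largeScaleShift_odd, zpow_add₀ two_ne_zero, two_zpow_neg_two_mul]
    simp
    ring

theorem exists_int_largeScaleShift (n : ℤ) : ∃ m : ℤ, largeScaleShift n = m := by
  refine ⟨∑ j ∈ Finset.Icc (n / 2 + 1) 0, 2 ^ (-2 * j).toNat, ?_⟩
  rw [largeScaleShift, Int.cast_sum]
  refine Finset.sum_congr rfl fun j hj => ?_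
  rw [Finset.mem_Icc] at hj
  push_cast
  rw [← zpow_natCast]
  congr 1
  omega

theorem relDist_le (δ : ℝ) (n : ℕ) (k : ℤ) :
    relDist δ ≤ (2 : ℝ) ^ n * |δ - (k : ℝ) / 2 ^ n| := by
  refine ciInf_le (f := fun q : ℕ × ℤ => (2 : ℝ) ^ q.1 * |δ - (q.2 : ℝ) / 2 ^ q.1|)
    ⟨0, ?_⟩ (n, k)
  rintro _ ⟨q, rfl⟩
  positivity

/-- In every generation the end points of the two grids are separated by a fixed proportion of
the length of the intervals. -/
theorem exists_separation {δ : ℝ} (hδ : 0 < relDist δ) :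
    ∃ c : ℝ, 0 < c ∧ c ≤ 1 ∧ ∀ n j k : ℤ,
      c * (1 / 2 ^ n) ≤ |(j : ℝ) / 2 ^ n + (δ + largeScaleShift n) - (k : ℝ) / 2 ^ n| := by
  set d := relDist δ
  -- A cell length of at least `B` makes `|δ - 1 / 3|` at most a sixth of it.
  set B : ℝ := 6 * |δ - 1 / 3| + 1
  have hB : 0 < B := by positivity
  have hB1 : 1 ≤ B := by simp only [B]; linarith [abs_nonneg (δ - 1 / 3)]
  refine ⟨min (1 / 6) (d / B), lt_min (by norm_num) (by positivity),
    (min_le_left _ _).trans (by norm_num), fun n j k => ?_⟩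
  have h2 : (0 : ℝ) < 2 ^ n := by positivity
  have hL : (0 : ℝ) < 1 / 2 ^ n := by positivity
  rcases le_total 0 n with hn | hn
  · rw [largeScaleShift_of_nonneg hn, add_zero]
    lift n to ℕ using hn
    have := relDist_le δ n (k - j)
    rw [← div_le_iff₀' (by positivity)] at this
    rw [zpow_natCast]
    calc _ ≤ d / B * (1 / 2 ^ n) := by gcongr; exact min_le_right _ _
      _ ≤ d * (1 / 2 ^ n) := by gcongr; exact div_le_self hδ.le hB1
      _ = d / 2 ^ n := by ring
      _ ≤ _ := this
      _ = _ := by congr 1; push_cast; ring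
  · rcases le_total (1 / 2 ^ n) B with h | h
    -- Intermediate scales: cell length and translation are integers, so the distance is at least
    -- that of `δ` from `ℤ`, hence at least `d`, while the length is at most `B`.
    · obtain ⟨m, hm⟩ := exists_int_largeScaleShift n
      obtain ⟨N, rfl⟩ : ∃ N : ℕ, n = -N := ⟨n.natAbs, by omega⟩
      have := relDist_le δ 0 (-(j * 2 ^ N) - m + k * 2 ^ N)
      rw [pow_zero, one_mul, div_one] at this
      calc _ ≤ d / B * (1 / 2 ^ (-N : ℤ)) := by gcongr; exact min_le_right _ _
        _ ≤ d / B * B := by gcongr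
        _ = d := by field_simp
        _ ≤ _ := this
        _ = _ := by
          congr 1
          rw [hm, zpow_neg, zpow_natCast]
          push_cast
          field_simp
          ring
    · obtain ⟨θ, hθ, h3⟩ := largeScaleShift_of_neg hn
      set L : ℝ := 1 / 2 ^ n
      have e : (j : ℝ) / 2 ^ n + (δ + largeScaleShift n) - (k : ℝ) / 2 ^ n
          = ((3 * j + θ - 3 * k : ℤ) : ℝ) * (L / 3) + (δ - 1 / 3) := by
        have : largeScaleShift n = (θ * L - 1) / 3 := by linarith
        rw [this, div_eq_mul_one_div (j : ℝ), div_eq_mul_one_div (k : ℝ)]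
        push_cast
        ring
      -- The integer is congruent to `θ` modulo 3, hence nonzero. This leaves a distance of `L / 3`,
      -- of which `δ - 1 / 3` can remove at most half.
      have h1 : (1 : ℝ) ≤ |((3 * j + θ - 3 * k : ℤ) : ℝ)| := by
        have : 1 ≤ |3 * j + θ - 3 * k| := Int.one_le_abs (by omega)
        exact_mod_cast this
      have h4 : L / 3 ≤ |((3 * j + θ - 3 * k : ℤ) : ℝ) * (L / 3)| := by
        rw [abs_mul, abs_of_pos (by positivity : (0 : ℝ) < L / 3)]
        exact le_mul_of_one_le_left (by positivity) h1
      have h5 := abs_sub_abs_le_abs_sub (((3 * j + θ - 3 * k : ℤ) : ℝ) * (L / 3)) (-(δ - 1 / 3))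
      rw [sub_neg_eq_add, abs_neg] at h5
      rw [e]
      calc _ ≤ 1 / 6 * L := by gcongr; exact min_le_left _ _
        _ ≤ _ := by simp only [B] at h; linarith

/-- Every interval lies in an interval of comparable length of one of the two grids. -/
theorem exists_cover {δ : ℝ} (hδ : 0 < relDist δ) :
    ∃ C : ℝ, 1 ≤ C ∧ ∀ a b : ℝ, a < b → ∃ s : ℤ → ℝ, ∃ n k : ℤ,
      (s = (fun _ => 0) ∨ s = fun n => δ + largeScaleShift n) ∧
      Ico a b ⊆ cell s n k ∧ 1 / 2 ^ n ≤ C * (b - a) := by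
  obtain ⟨c, hc, hc1, hsep⟩ := exists_separation hδ
  refine ⟨2 / c, by rw [le_div_iff₀ hc]; linarith, fun a b hab => ?_⟩
  -- This scale gives both `1 / 2 ^ n ≤ (2 / c) (b - a)` and `b - a < c / 2 ^ n`. If no cell of
  -- either grid contained the interval, each grid would have an end point inside it, contradicting
  -- the separation.
  obtain ⟨n, h1, h2⟩ := exists_zpow_scale (L := 2 * (b - a) / c)
    (div_pos (by linarith) hc)
  rw [div_lt_iff₀ hc] at h2
  by_contra hcon
  push Not at hcon
  have key : ∀ s : ℤ → ℝ, (s = (fun _ => 0) ∨ s = fun n => δ + largeScaleShift n) →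
      ∃ k : ℤ, a < (k : ℝ) / 2 ^ n + s n ∧ (k : ℝ) / 2 ^ n + s n < b := by
    intro s hs
    have hm := mem_cell_floor s n a
    refine ⟨⌊(a - s n) * 2 ^ n⌋ + 1, by exact_mod_cast hm.2, ?_⟩
    by_contra! hb
    have := hcon s n ⌊(a - s n) * 2 ^ n⌋ hs (Ico_subset_Ico hm.1 (by exact_mod_cast hb))
    have e : 2 / c * (b - a) = 2 * (b - a) / c := by ring
    linarith
  obtain ⟨k, hk1, hk2⟩ := key _ (.inl rfl)
  obtain ⟨j, hj1, hj2⟩ := key _ (.inr rfl)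
  have := hsep n j k
  rw [add_zero] at hk1 hk2
  have : |(j : ℝ) / 2 ^ n + (δ + largeScaleShift n) - (k : ℝ) / 2 ^ n| < b - a := by
    rw [abs_lt]
    constructor <;> linarith
  linarith

/-! ### Mass of intervals -/

variable {ω : ℝ → ℝ}

theorem IsWeight.aemeasurable (hω : IsWeight ω) : AEMeasurable ω :=
  hω.locallyIntegrable.aestronglyMeasurable.aemeasurable

theorem IsWeight.integrableOn_Ico (hω : IsWeight ω) (a b : ℝ) : IntegrableOn ω (Ico a b) :=
  (hω.locallyIntegrable.integrableOn_isCompact isCompact_Icc).mono_set Ico_subset_Icc_self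

theorem IsWeight.mass_Ico_ne_top (hω : IsWeight ω) (a b : ℝ) : mass ω (Ico a b) ≠ ∞ := by
  have := (hω.integrableOn_Ico a b).2
  rw [hasFiniteIntegral_iff_ofReal (.of_forall hω.nonneg)] at this
  exact this.ne

theorem mass_mono (ω : ℝ → ℝ) {E F : Set ℝ} (h : E ⊆ F) : mass ω E ≤ mass ω F :=
  lintegral_mono_set h

/-- The least constant is itself admissible. A finite infimum ensures `S` is nonempty; for `S = ∅`
and `y = 0` the right side would be `∞ * 0 = 0`. -/
theorem le_sInf_mul {S : Set ℝ≥0∞} {x y : ℝ≥0∞} (h : ∀ C ∈ S, x ≤ C * y) (hy : y ≠ ∞)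
    (hS : sInf S ≠ ∞) : x ≤ sInf S * y := by
  obtain ⟨C, hC⟩ : S.Nonempty := by
    rw [nonempty_iff_ne_empty]
    rintro rfl
    simp at hS
  rcases eq_or_ne y 0 with rfl | hy0
  · simpa using h C hC
  · rw [← ENNReal.div_le_iff hy0 hy]
    exact le_sInf fun D hD => (ENNReal.div_le_iff hy0 hy).2 (h D hD)

theorem mass_le_doublingConst_mul (hω : IsWeight ω) (h : doublingConst ω ≠ ∞) {a b : ℝ}
    (hab : a < b) :
    mass ω (Ico (a - (b - a) / 2) (b + (b - a) / 2)) ≤ doublingConst ω * mass ω (Ico a b) :=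
  le_sInf_mul (fun _ hC => hC a b hab) (hω.mass_Ico_ne_top a b) h

theorem mass_parent_le (hω : IsWeight ω) {s : ℤ → ℝ}
    (h : dyadicDoublingConst (offsetGrid s) ω ≠ ∞) {n j k : ℤ}
    (hjk : cell s n k ⊆ cell s (n - 1) j) :
    mass ω (cell s (n - 1) j) ≤ dyadicDoublingConst (offsetGrid s) ω * mass ω (cell s n k) :=
  le_sInf_mul (fun _ hC => hC n _ ⟨k, rfl⟩ _ ⟨j, rfl⟩ hjk) (hω.mass_Ico_ne_top _ _) h

theorem exists_ancestor (hω : IsWeight ω) {s : ℤ → ℝ} (hs : Nested s) {D : ℝ≥0∞} (hD : D ≠ ∞)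
    (h : dyadicDoublingConst (offsetGrid s) ω ≤ D) (n : ℤ) (N : ℕ) (k : ℤ) :
    ∃ j, cell s (n + N) k ⊆ cell s n j ∧ mass ω (cell s n j) ≤ D ^ N * mass ω (cell s (n + N) k) := by
  induction N generalizing k with
  | zero => exact ⟨k, by simp, by simp⟩
  | succ N ih =>
    obtain ⟨i, hi⟩ := exists_parent hs (n + (N + 1 : ℕ)) k
    have hm := mass_parent_le hω (ne_top_of_le_ne_top hD h) hi
    rw [show n + ((N + 1 : ℕ) : ℤ) - 1 = n + N by push_cast; ring] at hi hm
    obtain ⟨j, hj, hj2⟩ := ih i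
    refine ⟨j, hi.trans hj, hj2.trans ?_⟩
    calc _ ≤ D ^ N * (D * mass ω (cell s (n + (N + 1 : ℕ)) k)) := by gcongr; exact hm.trans (by gcongr)
      _ = _ := by ring

/-- A parent has at least the mass of its child. This disposes of `D < 1`, where powers of `D`
decrease in the exponent. -/
theorem mass_cell_eq_zero (hω : IsWeight ω) {s : ℤ → ℝ} (hs : Nested s)
    (h : dyadicDoublingConst (offsetGrid s) ω < 1) (n k : ℤ) : mass ω (cell s n k) = 0 := by
  obtain ⟨j, hj⟩ := exists_parent hs n k
  have h1 := mass_parent_le hω h.ne_top hj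
  by_contra h0
  have h2 : dyadicDoublingConst (offsetGrid s) ω * mass ω (cell s n k) < 1 * mass ω (cell s n k) :=
    ENNReal.mul_lt_mul_left h0 (hω.mass_Ico_ne_top _ _) h
  rw [one_mul] at h2
  exact absurd ((mass_mono ω hj).trans h1) h2.not_ge

/-- The mass of a grid interval is controlled by the mass of any subinterval of comparable
length. -/
theorem mass_cell_le_mul_mass (hω : IsWeight ω) {s : ℤ → ℝ} (hs : Nested s) {D : ℝ≥0∞} (hD : D ≠ ∞)
    (h : dyadicDoublingConst (offsetGrid s) ω ≤ D) {n k : ℤ} {a b R : ℝ} (hab : a < b)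
    (hsub : Ico a b ⊆ cell s n k) (hR : 1 / 2 ^ n ≤ R * (b - a)) :
    mass ω (cell s n k) ≤ D ^ Real.logb 2 (4 * R) * mass ω (Ico a b) := by
  rcases lt_or_ge D 1 with hD1 | hD1
  · rw [mass_cell_eq_zero hω hs (h.trans_lt hD1)]
    exact zero_le
  have hba : 0 < b - a := sub_pos.2 hab
  -- Cells of generation `m` are short enough for one to fit into `[a, b)`, yet longer than `(b - a)
  -- / 4`; the latter bounds the number `N` of generations by `2 ^ N ≤ 4 R`.
  obtain ⟨m, hm1, hm2⟩ := exists_zpow_scale (L := (b - a) / 2) (by linarith)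
  obtain ⟨i, hi⟩ := exists_cell_subset s (n := m) (a := a) (b := b) (by linarith)
  have hn : (0 : ℝ) < 2 ^ n := by positivity
  have hmpos : (0 : ℝ) < 2 ^ m := by positivity
  have hnm : n ≤ m := by
    have hv := measure_mono (μ := volume) (hi.trans hsub)
    rw [volume_cell, volume_cell, ENNReal.ofReal_le_ofReal_iff (by positivity)] at hv
    rw [one_div_le_one_div hmpos hn] at hv
    exact (zpow_le_zpow_iff_right₀ one_lt_two).1 hv
  obtain ⟨N, rfl⟩ : ∃ N : ℕ, m = n + N := ⟨(m - n).toNat, by omega⟩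
  obtain ⟨j, hj, hj2⟩ := exists_ancestor hω hs hD h n N i
  have hne : (cell s (n + N) i).Nonempty := by
    rw [cell, nonempty_Ico]
    gcongr
    linarith
  obtain ⟨x, hx⟩ := hne
  obtain rfl : j = k := eq_of_mem_cell (hj hx) (hsub (hi hx))
  have hN : (N : ℝ) ≤ Real.logb 2 (4 * R) := by
    have e : (2 : ℝ) ^ (n + N : ℤ) = 2 ^ n * 2 ^ N := by
      rw [zpow_add₀ two_ne_zero, zpow_natCast]
    have h2N : (2 : ℝ) ^ N ≤ 4 * R := by
      rw [e] at hm2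
      have h5 : (b - a) * (2 ^ n * 2 ^ N) < 4 := by
        rw [← lt_div_iff₀ (by positivity)]
        calc b - a = 2 * ((b - a) / 2) := by ring
          _ < 2 * (2 * (1 / (2 ^ n * 2 ^ N))) := by gcongr
          _ = _ := by ring
      rw [div_le_iff₀ hn] at hR
      have h6 : (b - a) * 2 ^ n * 2 ^ N ≤ (b - a) * 2 ^ n * (4 * R) := by nlinarith
      exact le_of_mul_le_mul_left h6 (by positivity)
    rw [Real.le_logb_iff_rpow_le one_lt_two (lt_of_lt_of_le (by positivity) h2N), Real.rpow_natCast]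
    exact h2N
  calc _ ≤ D ^ N * mass ω (cell s (n + N) i) := hj2
    _ ≤ D ^ (N : ℝ) * mass ω (Ico a b) := by
      rw [ENNReal.rpow_natCast]
      gcongr
      exact mass_mono ω hi
    _ ≤ _ := by
      gcongr

/-! ### Doubling weights -/

/-- The parent of `I` lies in the interval concentric with `I` and four times as long, so two
doublings suffice. -/
theorem dyadicDoublingConst_le_sq (hω : IsWeight ω) (s : ℤ → ℝ) {K : ℝ≥0}
    (h : doublingConst ω ≤ K) : dyadicDoublingConst (offsetGrid s) ω ≤ (K ^ 2 : ℝ≥0) := by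
  have hne : doublingConst ω ≠ ∞ := ne_top_of_le_ne_top ENNReal.coe_ne_top h
  have hd : ∀ a b : ℝ, a < b →
      mass ω (Ico (a - (b - a) / 2) (b + (b - a) / 2)) ≤ K * mass ω (Ico a b) := fun a b hab =>
    (mass_le_doublingConst_mul hω hne hab).trans (by gcongr)
  refine sInf_le ?_
  rintro n _ ⟨k, rfl⟩ _ ⟨j, rfl⟩ hsub
  have h2 : (0 : ℝ) < 2 ^ n := by positivity
  have h3 : (2 : ℝ) ^ (n - 1) = 2 ^ n / 2 := by
    rw [zpow_sub₀ two_ne_zero, zpow_one]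
  have hlt : (k : ℝ) / 2 ^ n + s n < ((k : ℝ) + 1) / 2 ^ n + s n := by
    gcongr
    linarith
  rw [cell, cell, Ico_subset_Ico_iff hlt] at hsub
  set a := (k : ℝ) / 2 ^ n + s n
  set b := ((k : ℝ) + 1) / 2 ^ n + s n
  set c := (j : ℝ) / 2 ^ (n - 1) + s (n - 1)
  set d := ((j : ℝ) + 1) / 2 ^ (n - 1) + s (n - 1)
  have hba : b - a = 1 / 2 ^ n := by simp only [a, b]; ring
  have hdc : d - c = 2 * (1 / 2 ^ n) := by simp only [c, d, h3]; field_simp; ring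
  have step := hd (a - (b - a) / 2) (b + (b - a) / 2) (by linarith)
  calc _ ≤ mass ω (Ico (a - (b - a) / 2 - (b + (b - a) / 2 - (a - (b - a) / 2)) / 2)
        (b + (b - a) / 2 + (b + (b - a) / 2 - (a - (b - a) / 2)) / 2)) :=
        mass_mono ω (Ico_subset_Ico (by linarith [hsub.1, hsub.2]) (by linarith [hsub.1, hsub.2]))
    _ ≤ _ := step
    _ ≤ K * (K * mass ω (Ico a b)) := by gcongr; exact hd a b hlt
    _ = _ := by rw [ENNReal.coe_pow]; simp only [cell, a, b]; ring

/-- The conclusion of `exists_cover`: every interval lies in an interval of one of the grids with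
offsets in `S` that is at most `C` times as long. -/
def Covers (S : Set (ℤ → ℝ)) (C : ℝ) : Prop :=
  ∀ a b : ℝ, a < b → ∃ s ∈ S, ∃ n k : ℤ, Ico a b ⊆ cell s n k ∧ 1 / 2 ^ n ≤ C * (b - a)

theorem doublingConst_le (hω : IsWeight ω) {S : Set (ℤ → ℝ)} {C : ℝ} (hC : 1 ≤ C)
    (hS : Covers S C) (hnest : ∀ s ∈ S, Nested s) {D : ℝ≥0∞}
    (hD : ∀ s ∈ S, dyadicDoublingConst (offsetGrid s) ω ≤ D) :
    doublingConst ω ≤ D ^ Real.logb 2 (2 ^ 3 * C) := by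
  rcases eq_or_ne D ∞ with rfl | hDtop
  · rw [ENNReal.top_rpow_of_pos]
    · exact le_top
    · exact Real.logb_pos one_lt_two (by linarith)
  refine sInf_le fun a b hab => ?_
  obtain ⟨s, hs, n, k, hsub, hlen⟩ := hS (a - (b - a) / 2) (b + (b - a) / 2) (by linarith)
  -- The cell covers the doubled interval, so relative to `[a, b)` its length is at most `2 C`.
  have := mass_cell_le_mul_mass hω (hnest s hs) hDtop (hD s hs) (R := 2 * C) hab
    ((Ico_subset_Ico (by linarith) (by linarith)).trans hsub) (by linarith)
  rw [show 4 * (2 * C) = 2 ^ 3 * C by ring] at this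
  exact (mass_mono ω hsub).trans this

/-! ### Averages -/

theorem nonnegAvg_le_mul (f : ℝ → ℝ≥0∞) {Q I : Set ℝ} {C : ℝ≥0∞} (hQI : Q ⊆ I)
    (hQ : volume Q ≠ 0) (hI : volume I ≠ ∞) (hC : volume I ≤ C * volume Q) :
    nonnegAvg f Q ≤ C * nonnegAvg f I := by
  have hI0 : volume I ≠ 0 := fun h => hQ (measure_mono_null hQI h)
  have hQt : volume Q ≠ ∞ := ne_top_of_le_ne_top hI (measure_mono hQI)
  rw [nonnegAvg, nonnegAvg, ENNReal.div_le_iff hQ hQt]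
  calc ∫⁻ x in Q, f x ≤ ∫⁻ x in I, f x := lintegral_mono_set hQI
    _ = (∫⁻ x in I, f x) / volume I * volume I := (ENNReal.div_mul_cancel hI0 hI).symm
    _ ≤ (∫⁻ x in I, f x) / volume I * (C * volume Q) := by gcongr
    _ = _ := by ring

theorem avg_eq (ω : ℝ → ℝ) (Q : Set ℝ) : avg ω Q = mass ω Q / volume Q := rfl

theorem volume_Ico_ne_zero {a b : ℝ} (hab : a < b) : volume (Ico a b) ≠ 0 := by
  simp [hab]

theorem volume_Ico_ne_top (a b : ℝ) : volume (Ico a b) ≠ ∞ := by simp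

theorem IsWeight.avg_Ico_ne_top (hω : IsWeight ω) {a b : ℝ} (hab : a < b) :
    avg ω (Ico a b) ≠ ∞ := by
  rw [avg_eq]
  exact ENNReal.div_ne_top (hω.mass_Ico_ne_top a b) (volume_Ico_ne_zero hab)

theorem avg_mul_volume (ω : ℝ → ℝ) {a b : ℝ} (hab : a < b) :
    avg ω (Ico a b) * volume (Ico a b) = mass ω (Ico a b) := by
  rw [avg_eq, ENNReal.div_mul_cancel (volume_Ico_ne_zero hab) (volume_Ico_ne_top a b)]

theorem mass_eq_zero_of_avg_eq_zero {a b : ℝ} (hab : a < b) (h : avg ω (Ico a b) = 0) :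
    mass ω (Ico a b) = 0 := by
  rw [← avg_mul_volume ω hab, h, zero_mul]

theorem avg_eq_zero_of_subset {Q : Set ℝ} {a b : ℝ} (hab : a < b) (hQ : Q ⊆ Ico a b)
    (h : avg ω (Ico a b) = 0) : avg ω Q = 0 := by
  have : mass ω Q = 0 :=
    le_antisymm ((mass_mono ω hQ).trans (mass_eq_zero_of_avg_eq_zero hab h).le) zero_le
  rw [avg_eq, this, ENNReal.zero_div]

theorem IsWeight.integral_Ico (hω : IsWeight ω) {a b : ℝ} (hab : a < b) :
    ∫ x in Ico a b, ω x = (avg ω (Ico a b)).toReal * (b - a) := by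
  have h1 : ∫ x in Ico a b, ω x = (mass ω (Ico a b)).toReal :=
    integral_eq_lintegral_of_nonneg_ae (.of_forall hω.nonneg) hω.aemeasurable.aestronglyMeasurable.restrict
  rw [h1, ← avg_mul_volume ω hab, ENNReal.toReal_mul, Real.volume_Ico,
    ENNReal.toReal_ofReal (by linarith)]

/-! ### Extended-real averages -/

theorem toENNReal_sub_div_le (P N : ℝ≥0∞) {v : ℝ} (hv : 0 < v) :
    (((P : EReal) - (N : EReal)) / (v : EReal)).toENNReal ≤ P / ENNReal.ofReal v := by
  induction P with
  | top => simp [ENNReal.top_div]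
  | coe p =>
    induction N with
    | top =>
      have : (((p : ℝ≥0∞) : EReal) - ((⊤ : ℝ≥0∞) : EReal)) / (v : EReal) = ⊥ := by
        rw [EReal.coe_ennreal_top, EReal.sub_top, EReal.bot_div_of_pos_ne_top (by exact_mod_cast hv)
          (EReal.coe_ne_top v)]
      rw [this]
      simp
    | coe n =>
      have : (((p : ℝ≥0∞) : EReal) - ((n : ℝ≥0∞) : EReal)) / (v : EReal)
          = (((p : ℝ) - n) / v : ℝ) := by
        rfl
      rw [this, EReal.toENNReal_of_ne_top (EReal.coe_ne_top _), EReal.toReal_coe,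
        ← ENNReal.ofReal_coe_nnreal, ← ENNReal.ofReal_div_of_pos hv]
      gcongr
      simp

/-- Recovers the positive part of an integral from its extended average. The negative part must be
finite, since `⊤ - ⊤ = ⊥` in `EReal`. -/
theorem le_mul_toENNReal_sub_div_add (P : ℝ≥0∞) {N : ℝ≥0∞} (hN : N ≠ ∞) {v : ℝ} (hv : 0 < v) :
    P ≤ ENNReal.ofReal v * (((P : EReal) - (N : EReal)) / (v : EReal)).toENNReal + N := by
  lift N to ℝ≥0 using hN
  induction P with
  | top =>
    have : (((⊤ : ℝ≥0∞) : EReal) - ((N : ℝ≥0∞) : EReal)) / (v : EReal) = ⊤ := by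
      rw [EReal.coe_ennreal_top, EReal.top_sub (by exact_mod_cast EReal.coe_ne_top _),
        EReal.top_div_of_pos_ne_top (by exact_mod_cast hv) (EReal.coe_ne_top v)]
    rw [this, EReal.toENNReal_top, ENNReal.mul_top (by simpa using hv)]
    simp
  | coe p =>
    have : (((p : ℝ≥0∞) : EReal) - ((N : ℝ≥0∞) : EReal)) / (v : EReal)
        = (((p : ℝ) - N) / v : ℝ) := by
      rfl
    rw [this, EReal.toENNReal_of_ne_top (EReal.coe_ne_top _), EReal.toReal_coe,
      ← ENNReal.ofReal_mul hv.le, mul_div_cancel₀ _ hv.ne', ← ENNReal.ofReal_coe_nnreal,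
      ← ENNReal.ofReal_coe_nnreal (p := N)]
    refine le_trans (ENNReal.ofReal_le_ofReal ?_) ENNReal.ofReal_add_le
    linarith

theorem extendedAvg_of_integrableOn {f : ℝ → EReal} {g : ℝ → ℝ} {Q : Set ℝ}
    (hfg : ∀ᵐ x ∂volume.restrict Q, f x = g x) (hg : IntegrableOn g Q) :
    extendedAvg f Q = ((∫ x in Q, g x) / volume.real Q : ℝ) := by
  have h1 : ∫⁻ x in Q, (f x).toENNReal = ∫⁻ x in Q, ENNReal.ofReal (g x) :=
    lintegral_congr_ae (by filter_upwards [hfg] with x hx; rw [hx]; rfl)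
  have h2 : ∫⁻ x in Q, (-f x).toENNReal = ∫⁻ x in Q, ENNReal.ofReal (-g x) :=
    lintegral_congr_ae (by filter_upwards [hfg] with x hx; rw [hx]; rfl)
  have f1 : ∫⁻ x in Q, ENNReal.ofReal (g x) ≠ ∞ := hg.lintegral_lt_top.ne
  have f2 : ∫⁻ x in Q, ENNReal.ofReal (-g x) ≠ ∞ := hg.neg.lintegral_lt_top.ne
  rw [extendedAvg, h1, h2, integral_eq_lintegral_pos_part_sub_lintegral_neg_part hg,
    ← EReal.coe_toReal (x := ((∫⁻ x in Q, ENNReal.ofReal (g x) : ℝ≥0∞) : EReal)),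
    ← EReal.coe_toReal (x := ((∫⁻ x in Q, ENNReal.ofReal (-g x) : ℝ≥0∞) : EReal))]
  · simp only [EReal.toReal_coe_ennreal]
    rfl
  all_goals simp [f1, f2]

/-! ### Muckenhoupt classes -/

theorem iSup_le_of_covers {S : Set (ℤ → ℝ)} {C : ℝ} (hS : Covers S C) (hC : 0 ≤ C)
    {F : Set ℝ → ℝ≥0∞} {B : ℝ≥0∞}
    (h : ∀ s ∈ S, ∀ n k : ℤ, ∀ a b : ℝ, a < b → Ico a b ⊆ cell s n k → 1 / 2 ^ n ≤ C * (b - a) →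
      volume (cell s n k) ≤ ENNReal.ofReal C * volume (Ico a b) → F (Ico a b) ≤ B) :
    ⨆ Q ∈ allIntervals, F Q ≤ B := by
  refine iSup₂_le ?_
  rintro _ ⟨a, b, hab, rfl⟩
  obtain ⟨s, hs, n, k, h1, h2⟩ := hS a b hab
  refine h s hs n k a b hab h1 h2 ?_
  rw [volume_cell, Real.volume_Ico, ← ENNReal.ofReal_mul hC]
  exact ENNReal.ofReal_le_ofReal h2

/-- Each of the two averages costs a factor `C`, the second one to the power `p - 1`. For `p = 1`
the essential infimum only decreases on the larger set. -/
theorem apQuantity_le_of_lt_top (ω : ℝ → ℝ) {p : ℝ≥0∞} (hp : 1 ≤ p) (hp' : p < ∞) {Q I : Set ℝ} {C : ℝ}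
    (hC : 1 ≤ C) (hQI : Q ⊆ I) (hQ : volume Q ≠ 0) (hI : volume I ≠ ∞)
    (hCv : volume I ≤ ENNReal.ofReal C * volume Q) :
    apQuantity p ω Q ≤ ENNReal.ofReal C ^ p.toReal * apQuantity p ω I := by
  rw [apQuantity, apQuantity]
  have h0 : avg ω Q ≤ ENNReal.ofReal C * avg ω I := nonnegAvg_le_mul _ hQI hQ hI hCv
  split_ifs with h1 h2
  · subst h1
    rw [ENNReal.toReal_one, ENNReal.rpow_one, ← mul_assoc]
    gcongr
    exact essInf_antitone_measure (Measure.restrict_mono hQI le_rfl).absolutelyContinuous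
  · exact absurd h2 hp'.ne
  · have hp1 : 1 < p.toReal := by
      rw [← ENNReal.toReal_one]
      exact (ENNReal.toReal_lt_toReal (by simp) hp'.ne).2 (lt_of_le_of_ne hp (Ne.symm h1))
    have hpos : 0 < ENNReal.ofReal C := by simp; linarith
    have e : ENNReal.ofReal C ^ p.toReal = ENNReal.ofReal C * ENNReal.ofReal C ^ (p.toReal - 1) := by
      nth_rw 1 [show p.toReal = 1 + (p.toReal - 1) by ring]
      rw [ENNReal.rpow_add _ _ hpos.ne' ENNReal.ofReal_ne_top, ENNReal.rpow_one]
    rw [e]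
    set f : ℝ → ℝ≥0∞ := fun x => (ENNReal.ofReal (ω x))⁻¹ ^ (1 / (p.toReal - 1))
    calc _ ≤ (ENNReal.ofReal C * avg ω I) * (ENNReal.ofReal C * nonnegAvg f I) ^ (p.toReal - 1) := by
          gcongr
          exact nonnegAvg_le_mul _ hQI hQ hI hCv
      _ = _ := by
        rw [ENNReal.mul_rpow_of_nonneg _ _ (by linarith)]
        ring

theorem apConst_le_of_lt_top (ω : ℝ → ℝ) {p : ℝ≥0∞} (hp : 1 ≤ p) (hp' : p < ∞) {S : Set (ℤ → ℝ)}
    {C : ℝ} (hC : 1 ≤ C) (hS : Covers S C) {K : ℝ≥0∞}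
    (hK : ∀ s ∈ S, apConst (gridIntervals (offsetGrid s)) p ω ≤ K) :
    apConst allIntervals p ω ≤ ENNReal.ofReal C ^ p.toReal * K := by
  refine iSup_le_of_covers hS (by linarith) fun s hs n k a b hab hsub _ hvol => ?_
  refine (apQuantity_le_of_lt_top ω hp hp' hC hsub (volume_Ico_ne_zero hab) (volume_Ico_ne_top _ _)
    hvol).trans ?_
  gcongr
  exact (le_iSup₂ (f := fun Q _ => apQuantity p ω Q) _ (cell_mem_gridIntervals s n k)).trans (hK s hs)

theorem log_inv_ofReal {x : ℝ} (hx : 0 < x) :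
    ENNReal.log (ENNReal.ofReal x)⁻¹ = ((-Real.log x : ℝ) : EReal) := by
  rw [ENNReal.log_inv, ENNReal.log_ofReal_of_pos hx]
  rfl

/-- If the logarithmic average is not `∞`, then the logarithm of the weight is integrable. -/
theorem integrableOn_log (hω : IsWeight ω) {a b : ℝ} (hab : a < b)
    (h : extendedAvg (fun x => ENNReal.log (ENNReal.ofReal (ω x))⁻¹) (Ico a b) ≠ ⊤) :
    (∀ᵐ x ∂volume.restrict (Ico a b), 0 < ω x) ∧
      IntegrableOn (fun x => -Real.log (ω x)) (Ico a b) := by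
  set φ : ℝ → EReal := fun x => ENNReal.log (ENNReal.ofReal (ω x))⁻¹
  have hφ0 : ∀ x, ω x = 0 → φ x = ⊤ := fun x hx => by simp [φ, hx]
  have hφ : ∀ x, 0 < ω x → φ x = ((-Real.log (ω x) : ℝ) : EReal) := fun x hx => log_inv_ofReal hx
  have hm : AEMeasurable ω (volume.restrict (Ico a b)) := hω.aemeasurable.restrict
  -- The negative part of `log (1 / ω)` is at most `ω`, which is locally integrable.
  have hN : ∫⁻ x in Ico a b, (-φ x).toENNReal ≠ ∞ := by
    refine ne_top_of_le_ne_top (hω.mass_Ico_ne_top a b) (lintegral_mono fun x => ?_)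
    rcases (hω.nonneg x).eq_or_lt with h0 | h0
    · rw [hφ0 x h0.symm]
      simp
    · rw [hφ x h0, ← EReal.coe_neg, neg_neg]
      exact ENNReal.ofReal_le_ofReal (Real.log_le_self h0.le)
  have hP : ∫⁻ x in Ico a b, (φ x).toENNReal ≠ ∞ := by
    have hv : 0 < volume.real (Ico a b) := by simpa using hab
    refine ne_top_of_le_ne_top ?_ (le_mul_toENNReal_sub_div_add _ hN hv)
    refine ENNReal.add_ne_top.2 ⟨ENNReal.mul_ne_top ENNReal.ofReal_ne_top ?_, hN⟩
    exact EReal.toENNReal_eq_top_iff.not.2 h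
  have hφm : AEMeasurable (fun x => (φ x).toENNReal) (volume.restrict (Ico a b)) := by
    fun_prop
  have hpos : ∀ᵐ x ∂volume.restrict (Ico a b), 0 < ω x := by
    filter_upwards [ae_lt_top' hφm hP] with x hx
    refine (hω.nonneg x).lt_of_ne fun h0 => ?_
    rw [hφ0 x h0.symm] at hx
    simp at hx
  refine ⟨hpos, ?_⟩
  have hlm : AEMeasurable (fun x => -Real.log (ω x)) (volume.restrict (Ico a b)) := by fun_prop
  refine ⟨hlm.aestronglyMeasurable, ?_⟩
  rw [hasFiniteIntegral_iff_norm]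
  refine lt_of_le_of_lt ?_ (ENNReal.add_lt_top.2 ⟨hP.lt_top, hN.lt_top⟩)
  rw [← lintegral_add_left' hφm]
  refine lintegral_mono_ae ?_
  filter_upwards [hpos] with x hx
  rw [hφ x hx, ← EReal.coe_neg, EReal.toENNReal_of_ne_top (EReal.coe_ne_top _),
    EReal.toENNReal_of_ne_top (EReal.coe_ne_top _), EReal.toReal_coe, EReal.toReal_coe]
  rw [Real.norm_eq_abs]
  rcases le_total 0 (-Real.log (ω x)) with h1 | h1
  · rw [abs_of_nonneg h1]
    exact le_self_add
  · rw [abs_of_nonpos h1]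
    exact le_add_self

theorem apQuantity_top (ω : ℝ → ℝ) (Q : Set ℝ) : apQuantity ∞ ω Q =
    avg ω Q * EReal.exp (extendedAvg (fun x => ENNReal.log (ENNReal.ofReal (ω x))⁻¹) Q) := by
  simp [apQuantity]

/-- With `A` the average over the large interval `I`, the positive part of `log (A / ω)` is at most
`log (A / ω) + ω / A`, whose integral over `I` is at most `|I| (log K + 1)`. The positive part is
monotone in the interval, so the average of `log (1 / ω)` over the small interval is at most `C (log
K + 1) - log A`. The factor `1 / A` cancels against the bound `C A` for the average of `ω`. -/
theorem apQuantity_top_le (hω : IsWeight ω) {a b c d C K : ℝ} (hab : a < b)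
    (hsub : Ico a b ⊆ Ico c d) (hC : d - c ≤ C * (b - a))
    (hK : apQuantity ∞ ω (Ico c d) ≤ ENNReal.ofReal K) :
    apQuantity ∞ ω (Ico a b) ≤ ENNReal.ofReal (C * Real.exp (C * (Real.log K + 1))) := by
  have hcd : c < d := by
    rw [Ico_subset_Ico_iff hab] at hsub
    linarith [hsub.1, hsub.2]
  rw [apQuantity_top] at hK ⊢
  rcases eq_or_ne (avg ω (Ico c d)) 0 with h0 | h0
  · rw [avg_eq_zero_of_subset hcd hsub h0, zero_mul]
    exact zero_le
  have hfin : extendedAvg (fun x => ENNReal.log (ENNReal.ofReal (ω x))⁻¹) (Ico c d) ≠ ⊤ := by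
    intro h
    rw [h, EReal.exp_top, ENNReal.mul_top h0] at hK
    simp at hK
  obtain ⟨hpos, hint⟩ := integrableOn_log hω hcd hfin
  have hposQ : ∀ᵐ x ∂volume.restrict (Ico a b), 0 < ω x := ae_restrict_of_ae_restrict_of_subset hsub hpos
  have hintQ := hint.mono_set hsub
  rw [extendedAvg_of_integrableOn (by filter_upwards [hpos] with x hx using log_inv_ofReal hx) hint]
    at hK
  rw [extendedAvg_of_integrableOn (by filter_upwards [hposQ] with x hx using log_inv_ofReal hx) hintQ]
  rw [EReal.exp_coe] at hK ⊢
  set A := (avg ω (Ico c d)).toReal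
  have hA : 0 < A := ENNReal.toReal_pos h0 (hω.avg_Ico_ne_top hcd)
  have hAe : avg ω (Ico c d) = ENNReal.ofReal A :=
    (ENNReal.ofReal_toReal (hω.avg_Ico_ne_top hcd)).symm
  have hvQ : volume.real (Ico a b) = b - a := Real.volume_real_Ico_of_le hab.le
  have hvI : volume.real (Ico c d) = d - c := Real.volume_real_Ico_of_le hcd.le
  have hba : 0 < b - a := sub_pos.2 hab
  have hdc : 0 < d - c := sub_pos.2 hcd
  rw [hvI, hAe, ← ENNReal.ofReal_mul hA.le] at hK
  rw [hvQ]
  have hK0 : 0 < K := by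
    by_contra! hK0
    rw [ENNReal.ofReal_of_nonpos hK0, nonpos_iff_eq_zero, ENNReal.ofReal_eq_zero] at hK
    exact absurd hK (not_le.2 (by positivity))
  rw [ENNReal.ofReal_le_ofReal_iff hK0.le] at hK
  set X := ∫ x in Ico c d, -Real.log (ω x)
  set Y := ∫ x in Ico a b, -Real.log (ω x)
  have hX : X ≤ (d - c) * (Real.log K - Real.log A) := by
    rw [← div_le_iff₀' hdc, ← Real.log_div hK0.ne' hA.ne', Real.le_log_iff_exp_le (by positivity),
      le_div_iff₀' hA]
    exact hK
  have hcI : IntegrableOn (fun _ : ℝ => Real.log A) (Ico c d) := by simp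
  have hh : IntegrableOn (fun x => -Real.log (ω x) + Real.log A) (Ico c d) := hint.add hcI
  have hp : IntegrableOn (fun x => max (-Real.log (ω x) + Real.log A) 0) (Ico c d) := hh.pos_part
  have hωA : IntegrableOn (fun x => ω x / A) (Ico c d) := (hω.integrableOn_Ico c d).div_const A
  have h1 : ∫ x in Ico c d, max (-Real.log (ω x) + Real.log A) 0 ≤ (d - c) * (Real.log K + 1) := by
    calc _ ≤ ∫ x in Ico c d, ((-Real.log (ω x) + Real.log A) + ω x / A) := by
          refine setIntegral_mono_ae_restrict hp (hh.add hωA) ?_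
          filter_upwards [hpos] with x hx
          have := Real.log_le_self (x := ω x / A) (by positivity)
          rw [Real.log_div hx.ne' hA.ne'] at this
          have h3 : 0 ≤ ω x / A := by positivity
          exact max_le (by linarith) (by linarith)
      _ = X + (d - c) * Real.log A + (d - c) := by
          rw [integral_add hh hωA, integral_add hint hcI, integral_div, hω.integral_Ico hcd]
          rw [setIntegral_const, hvI, smul_eq_mul]
          congr 1
          change A * (d - c) / A = d - c
          field_simp
      _ ≤ _ := by linarith
  have h2 : 0 ≤ ∫ x in Ico c d, max (-Real.log (ω x) + Real.log A) 0 :=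
    integral_nonneg fun x => le_max_right _ _
  have h3 : Y + (b - a) * Real.log A ≤ (d - c) * (Real.log K + 1) := by
    calc Y + (b - a) * Real.log A = ∫ x in Ico a b, (-Real.log (ω x) + Real.log A) := by
          rw [integral_add hintQ (hcI.mono_set hsub), setIntegral_const, hvQ, smul_eq_mul]
      _ ≤ ∫ x in Ico a b, max (-Real.log (ω x) + Real.log A) 0 :=
          integral_mono (hh.mono_set hsub) (hp.mono_set hsub) fun x => le_max_left _ _
      _ ≤ ∫ x in Ico c d, max (-Real.log (ω x) + Real.log A) 0 :=
          setIntegral_mono_set hp (.of_forall fun x => le_max_right _ _) hsub.eventuallyLE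
      _ ≤ _ := h1
  -- Nonnegativity is what allows the ratio of lengths to be replaced by its upper bound `C`.
  have h4 : 0 ≤ Real.log K + 1 := by
    by_contra! h4
    linarith [mul_neg_of_pos_of_neg hdc h4]
  have h5 : Y / (b - a) ≤ C * (Real.log K + 1) - Real.log A := by
    rw [div_le_iff₀ hba]
    nlinarith
  have hC0 : 0 ≤ C := by
    by_contra! hC0
    nlinarith
  have h6 : avg ω (Ico a b) ≤ ENNReal.ofReal (C * A) := by
    rw [ENNReal.ofReal_mul hC0, ← hAe]
    refine nonnegAvg_le_mul _ hsub (volume_Ico_ne_zero hab) (volume_Ico_ne_top _ _) ?_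
    rw [Real.volume_Ico, Real.volume_Ico, ← ENNReal.ofReal_mul hC0]
    exact ENNReal.ofReal_le_ofReal hC
  calc _ ≤ ENNReal.ofReal (C * A) * ENNReal.ofReal (Real.exp (C * (Real.log K + 1) - Real.log A)) := by
        gcongr
    _ = _ := by
      rw [← ENNReal.ofReal_mul (by positivity), Real.exp_sub, Real.exp_log hA]
      congr 1
      field_simp

theorem apConst_top_le (hω : IsWeight ω) {S : Set (ℤ → ℝ)} {C : ℝ} (hC : 1 ≤ C) (hS : Covers S C)
    {K : ℝ} (hK : ∀ s ∈ S, apConst (gridIntervals (offsetGrid s)) ∞ ω ≤ ENNReal.ofReal K) :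
    apConst allIntervals ∞ ω ≤ ENNReal.ofReal (C * Real.exp (C * (Real.log K + 1))) := by
  refine iSup_le_of_covers hS (by linarith) fun s hs n k a b hab hsub hlen _ => ?_
  refine apQuantity_top_le hω hab hsub (le_of_eq_of_le ?_ hlen)
    ((le_iSup₂ (f := fun Q _ => apQuantity ∞ ω Q) _ (cell_mem_gridIntervals s n k)).trans (hK s hs))
  ring

/-! ### Reverse Hölder classes: from the grids to all intervals -/

/-- The reverse Hölder quantities divide by the average over `Q`, so a lower bound for it is needed;
this is where doubling enters. -/
theorem inv_avg_le_mul {Q : Set ℝ} {c d : ℝ} {E : ℝ≥0∞} (hω : IsWeight ω) (hcd : c < d)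
    (hsub : Q ⊆ Ico c d) (hE : mass ω (Ico c d) ≤ E * mass ω Q) (hQ : avg ω Q ≠ 0) :
    avg ω (Ico c d) ≤ E * avg ω Q ∧ (avg ω Q)⁻¹ ≤ E * (avg ω (Ico c d))⁻¹ := by
  have h1 : avg ω (Ico c d) ≤ E * avg ω Q := by
    rw [avg_eq, avg_eq, ← mul_div_assoc]
    exact ENNReal.div_le_div hE (measure_mono hsub)
  refine ⟨h1, ?_⟩
  have hI0 : avg ω (Ico c d) ≠ 0 := fun h => hQ (avg_eq_zero_of_subset hcd hsub h)
  have hIt := hω.avg_Ico_ne_top hcd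
  calc (avg ω Q)⁻¹ = avg ω (Ico c d) / avg ω Q * (avg ω (Ico c d))⁻¹ := by
        rw [div_eq_mul_inv, mul_right_comm, ENNReal.mul_inv_cancel hI0 hIt, one_mul]
    _ ≤ _ := by
        gcongr
        exact ENNReal.div_le_of_le_mul h1

theorem ofReal_weight_ae_eq_zero (hω : IsWeight ω) {a b : ℝ} (hab : a < b)
    (h : avg ω (Ico a b) = 0) :
    (fun x => ENNReal.ofReal (ω x)) =ᵐ[volume.restrict (Ico a b)] 0 :=
  (lintegral_eq_zero_iff' hω.aemeasurable.ennreal_ofReal.restrict).1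
    (mass_eq_zero_of_avg_eq_zero hab h)

theorem rhQuantity_top (ω : ℝ → ℝ) (Q : Set ℝ) : rhQuantity ∞ ω Q =
    essSup (fun x => ENNReal.ofReal (ω x)) (volume.restrict Q) * (avg ω Q)⁻¹ := by
  simp [rhQuantity]

theorem rhQuantity_of_lt_top {p : ℝ≥0∞} (hp : 1 < p) (hp' : p < ∞) (ω : ℝ → ℝ) (Q : Set ℝ) :
    rhQuantity p ω Q =
      nonnegAvg (fun x => ENNReal.ofReal (ω x) ^ p.toReal) Q ^ (1 / p.toReal) * (avg ω Q)⁻¹ := by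
  simp [rhQuantity, hp.ne', hp'.ne]

theorem rhQuantity_le_of_lt_top (hω : IsWeight ω) {p : ℝ≥0∞} (hp : 1 < p) (hp' : p < ∞)
    {a b c d : ℝ} (hab : a < b) (hcd : c < d) {C E : ℝ≥0∞} (hsub : Ico a b ⊆ Ico c d)
    (hC : volume (Ico c d) ≤ C * volume (Ico a b))
    (hE : mass ω (Ico c d) ≤ E * mass ω (Ico a b)) :
    rhQuantity p ω (Ico a b) ≤ C ^ (1 / p.toReal) * E * rhQuantity p ω (Ico c d) := by
  rw [rhQuantity_of_lt_top hp hp', rhQuantity_of_lt_top hp hp']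
  have hp0 : 0 < p.toReal := ENNReal.toReal_pos (by positivity) hp'.ne
  set f : ℝ → ℝ≥0∞ := fun x => ENNReal.ofReal (ω x) ^ p.toReal
  -- At average zero the inverse is `∞`, but the other factor vanishes and `0 * ∞ = 0`.
  rcases eq_or_ne (avg ω (Ico a b)) 0 with h0 | h0
  · have : nonnegAvg f (Ico a b) = 0 := by
      rw [nonnegAvg, lintegral_congr_ae (g := 0), Pi.zero_def, lintegral_zero, ENNReal.zero_div]
      filter_upwards [ofReal_weight_ae_eq_zero hω hab h0] with x hx
      simp only [f, hx, Pi.zero_apply, ENNReal.zero_rpow_of_pos hp0]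
    rw [this, ENNReal.zero_rpow_of_pos (by positivity), zero_mul]
    exact zero_le
  · have h1 := nonnegAvg_le_mul f hsub (volume_Ico_ne_zero hab) (volume_Ico_ne_top _ _) hC
    calc _ ≤ (C * nonnegAvg f (Ico c d)) ^ (1 / p.toReal) * (E * (avg ω (Ico c d))⁻¹) := by
          gcongr
          exact (inv_avg_le_mul hω hcd hsub hE h0).2
      _ = _ := by
        rw [ENNReal.mul_rpow_of_nonneg _ _ (by positivity)]
        ring

theorem rhQuantity_top_le (hω : IsWeight ω) {a b c d : ℝ} (hab : a < b) (hcd : c < d) {E : ℝ≥0∞}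
    (hsub : Ico a b ⊆ Ico c d) (hE : mass ω (Ico c d) ≤ E * mass ω (Ico a b)) :
    rhQuantity ∞ ω (Ico a b) ≤ E * rhQuantity ∞ ω (Ico c d) := by
  rw [rhQuantity_top, rhQuantity_top]
  rcases eq_or_ne (avg ω (Ico a b)) 0 with h0 | h0
  · rw [essSup_congr_ae (ofReal_weight_ae_eq_zero hω hab h0)]
    have : essSup (0 : ℝ → ℝ≥0∞) (volume.restrict (Ico a b)) = 0 := essSup_const_bot
    rw [this, zero_mul]
    exact zero_le
  · calc _ ≤ essSup (fun x => ENNReal.ofReal (ω x)) (volume.restrict (Ico c d)) *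
          (E * (avg ω (Ico c d))⁻¹) := by
          gcongr
          · exact essSup_mono_measure (Measure.restrict_mono hsub le_rfl).absolutelyContinuous
          · exact (inv_avg_le_mul hω hcd hsub hE h0).2
      _ = _ := by ring

theorem setAverage_Ico (hω : IsWeight ω) {a b : ℝ} (hab : a < b) :
    ⨍ y in Ico a b, ω y = (avg ω (Ico a b)).toReal := by
  have : b - a ≠ 0 := (sub_pos.2 hab).ne'
  rw [setAverage_eq, hω.integral_Ico hab, Real.volume_real_Ico_of_le hab.le, smul_eq_mul]
  field_simp

theorem mul_log_ge {t : ℝ} (ht : 0 ≤ t) : -1 ≤ t * Real.log t := by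
  rcases ht.eq_or_lt with rfl | ht
  · simp
  · have h := Real.one_sub_inv_le_log_of_pos ht
    have h2 := mul_le_mul_of_nonneg_left h ht.le
    rw [mul_sub, mul_inv_cancel₀ ht.ne'] at h2
    linarith

/-- The positive part of the integral in the `RH_1` condition. -/
noncomputable def entropy (ω : ℝ → ℝ) (Q : Set ℝ) : ℝ≥0∞ :=
  ∫⁻ x in Q, ENNReal.ofReal (ω x / (avg ω Q).toReal * Real.log (ω x / (avg ω Q).toReal))

/-- Since `t log t ≥ -1`, dropping the negative part changes the average by at most 1, and the
positive part is monotone in the domain of integration. -/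
theorem rhQuantity_one (hω : IsWeight ω) {a b : ℝ} (hab : a < b) :
    rhQuantity 1 ω (Ico a b) ≤ entropy ω (Ico a b) / ENNReal.ofReal (b - a) ∧
      entropy ω (Ico a b) ≤ ENNReal.ofReal (b - a) * (rhQuantity 1 ω (Ico a b) + 1) := by
  have hba : 0 < b - a := sub_pos.2 hab
  set A := (avg ω (Ico a b)).toReal with hA
  have e : rhQuantity 1 ω (Ico a b) = (((entropy ω (Ico a b) : EReal) -
      ((∫⁻ x in Ico a b, ENNReal.ofReal (-(ω x / A * Real.log (ω x / A))) : ℝ≥0∞) : EReal)) /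
        ((b - a : ℝ) : EReal)).toENNReal := by
    rw [rhQuantity, if_pos rfl, extendedAvg, setAverage_Ico hω hab,
      Real.volume_real_Ico_of_le hab.le]
    rfl
  have hN : ∫⁻ x in Ico a b, ENNReal.ofReal (-(ω x / A * Real.log (ω x / A))) ≤
      ENNReal.ofReal (b - a) := by
    calc _ ≤ ∫⁻ x in Ico a b, 1 := by
          refine lintegral_mono fun x => ?_
          rw [← ENNReal.ofReal_one]
          apply ENNReal.ofReal_le_ofReal
          have := mul_log_ge (t := ω x / A) (div_nonneg (hω.nonneg x) ENNReal.toReal_nonneg)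
          linarith
      _ = _ := by simp
  rw [e]
  refine ⟨toENNReal_sub_div_le _ _ hba, ?_⟩
  rw [mul_add, mul_one]
  exact (le_mul_toENNReal_sub_div_add _ (ne_top_of_le_ne_top ENNReal.ofReal_ne_top hN) hba).trans
    (by gcongr)

theorem lintegral_div_avg (hω : IsWeight ω) {a b : ℝ} (hab : a < b) (h0 : avg ω (Ico a b) ≠ 0) :
    ∫⁻ x in Ico a b, ENNReal.ofReal (ω x / (avg ω (Ico a b)).toReal) =
      ENNReal.ofReal (b - a) := by
  have hA := ENNReal.toReal_pos h0 (hω.avg_Ico_ne_top hab)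
  simp_rw [ENNReal.ofReal_div_of_pos hA, ENNReal.ofReal_toReal (hω.avg_Ico_ne_top hab),
    div_eq_mul_inv]
  rw [lintegral_mul_const'' _ hω.aemeasurable.ennreal_ofReal.restrict]
  change mass ω (Ico a b) * _ = _
  rw [← avg_mul_volume ω hab, mul_right_comm,
    ENNReal.mul_inv_cancel h0 (hω.avg_Ico_ne_top hab), one_mul, Real.volume_Ico]

/-- Let `A`, `B` be the averages over the large and the small interval, `t = A / B ≤ E` and `u = ω /
A`. Then `t u log (t u) = t u log u + t u log t` has positive part at most `E (u log u)⁺ + E² u`,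
and `u` has average 1 over the large interval. -/
theorem rhQuantity_one_le (hω : IsWeight ω) {a b c d : ℝ} (hab : a < b) (hcd : c < d) {C E : ℝ}
    {K : ℝ≥0∞} (hE0 : 0 ≤ E) (hsub : Ico a b ⊆ Ico c d) (hC : d - c ≤ C * (b - a))
    (hE : mass ω (Ico c d) ≤ ENNReal.ofReal E * mass ω (Ico a b))
    (hK : rhQuantity 1 ω (Ico c d) ≤ K) :
    rhQuantity 1 ω (Ico a b) ≤
      ENNReal.ofReal C * (ENNReal.ofReal E * (K + 1) + ENNReal.ofReal (E * E)) := by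
  refine (rhQuantity_one hω hab).1.trans ?_
  have hba : 0 < b - a := sub_pos.2 hab
  have hba' : ENNReal.ofReal (b - a) ≠ 0 := by simpa using hab
  rcases eq_or_ne (avg ω (Ico a b)) 0 with h0 | h0
  · have : entropy ω (Ico a b) = 0 := by simp [entropy, h0]
    rw [this, ENNReal.zero_div]
    exact zero_le
  have hI0 : avg ω (Ico c d) ≠ 0 := fun h => h0 (avg_eq_zero_of_subset hcd hsub h)
  have hIt := hω.avg_Ico_ne_top hcd
  have hQt := hω.avg_Ico_ne_top hab
  have hr := ENNReal.toReal_mono (ENNReal.mul_ne_top ENNReal.ofReal_ne_top hQt)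
    (inv_avg_le_mul hω hcd hsub hE h0).1
  rw [ENNReal.toReal_mul, ENNReal.toReal_ofReal hE0] at hr
  have hint := lintegral_div_avg hω hcd hI0
  have hent := (rhQuantity_one hω hcd).2
  rw [entropy] at hent ⊢
  have hA : 0 < (avg ω (Ico c d)).toReal := ENNReal.toReal_pos hI0 hIt
  have hB : 0 < (avg ω (Ico a b)).toReal := ENNReal.toReal_pos h0 hQt
  set A := (avg ω (Ico c d)).toReal
  set B := (avg ω (Ico a b)).toReal
  have hpt : ∀ x, ENNReal.ofReal (ω x / B * Real.log (ω x / B)) ≤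
      ENNReal.ofReal E * ENNReal.ofReal (ω x / A * Real.log (ω x / A)) +
        ENNReal.ofReal (E * E) * ENNReal.ofReal (ω x / A) := by
    intro x
    rw [← ENNReal.ofReal_mul hE0, ← ENNReal.ofReal_mul (by positivity)]
    rcases (hω.nonneg x).eq_or_lt with h | h
    · simp [← h]
    set t := A / B
    set u := ω x / A
    have ht : 0 < t := by positivity
    have hu : 0 < u := by positivity
    have htE : t ≤ E := (div_le_iff₀ hB).2 hr
    have hlt : Real.log t ≤ E := (Real.log_le_self ht.le).trans htE
    have : ω x / B = t * u := by simp only [t, u]; field_simp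
    rw [this, Real.log_mul ht.ne' hu.ne']
    have h2 : t * u * Real.log t ≤ E * E * u := by
      calc _ ≤ t * u * E := by gcongr
        _ ≤ E * u * E := by gcongr
        _ = _ := by ring
    rcases le_total 0 (Real.log u) with h3 | h3
    · rw [← ENNReal.ofReal_add (by positivity) (by positivity)]
      apply ENNReal.ofReal_le_ofReal
      have : t * u * Real.log u ≤ E * (u * Real.log u) := by
        rw [mul_assoc]
        gcongr
      linarith
    · refine le_add_left (ENNReal.ofReal_le_ofReal ?_)
      have : t * u * Real.log u ≤ 0 := mul_nonpos_of_nonneg_of_nonpos (by positivity) h3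
      linarith
  have hm : AEMeasurable ω (volume.restrict (Ico c d)) := hω.aemeasurable.restrict
  rw [ENNReal.div_le_iff hba' ENNReal.ofReal_ne_top]
  calc _ ≤ ∫⁻ x in Ico c d, (ENNReal.ofReal E * ENNReal.ofReal (ω x / A * Real.log (ω x / A)) +
        ENNReal.ofReal (E * E) * ENNReal.ofReal (ω x / A)) :=
        (lintegral_mono_set hsub).trans (lintegral_mono hpt)
    _ = ENNReal.ofReal E * (∫⁻ x in Ico c d, ENNReal.ofReal (ω x / A * Real.log (ω x / A))) +
        ENNReal.ofReal (E * E) * ENNReal.ofReal (d - c) := by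
        rw [lintegral_add_left' (by fun_prop), lintegral_const_mul'' _ (by fun_prop),
          lintegral_const_mul'' _ (by fun_prop), hint]
    _ ≤ ENNReal.ofReal E * (ENNReal.ofReal (d - c) * (K + 1)) +
        ENNReal.ofReal (E * E) * ENNReal.ofReal (d - c) := by
        gcongr
        exact hent.trans (by gcongr)
    _ = ENNReal.ofReal (d - c) * (ENNReal.ofReal E * (K + 1) + ENNReal.ofReal (E * E)) := by ring
    _ ≤ ENNReal.ofReal C * ENNReal.ofReal (b - a) *
        (ENNReal.ofReal E * (K + 1) + ENNReal.ofReal (E * E)) := by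
        gcongr
        rw [← ENNReal.ofReal_mul' hba.le]
        exact ENNReal.ofReal_le_ofReal hC
    _ = _ := by ring

section Grids

variable {S : Set (ℤ → ℝ)} {C : ℝ}

theorem rhQuantity_cell_le {s : ℤ → ℝ} {p K : ℝ≥0∞} (h : rhDyadicConst (offsetGrid s) p ω ≤ K)
    (n k : ℤ) : rhQuantity p ω (cell s n k) ≤ K :=
  (le_iSup₂ (f := fun Q _ => rhQuantity p ω Q) _ (cell_mem_gridIntervals s n k)).trans
    ((le_max_left _ _).trans h)

theorem left_lt_right_cell (s : ℤ → ℝ) (n k : ℤ) :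
    (k : ℝ) / 2 ^ n + s n < ((k : ℝ) + 1) / 2 ^ n + s n := by
  gcongr
  linarith

theorem rhConst_le_of_lt_top (hω : IsWeight ω) {p : ℝ≥0∞} (hp : 1 < p) (hp' : p < ∞)
    (hC : 1 ≤ C) (hS : Covers S C) (hnest : ∀ s ∈ S, Nested s) {D K : ℝ≥0∞}
    (hD : ∀ s ∈ S, dyadicDoublingConst (offsetGrid s) ω ≤ D) (hDK : D ≤ K)
    (hK : ∀ s ∈ S, rhDyadicConst (offsetGrid s) p ω ≤ K) :
    rhConst allIntervals p ω ≤
      ENNReal.ofReal C ^ (1 / p.toReal) * D ^ Real.logb 2 (4 * C) * K := by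
  have hp0 : 0 < p.toReal := ENNReal.toReal_pos (by positivity) hp'.ne
  -- For `D = ∞` also `K = ∞`, so the right side is `∞` and not a product `∞ * 0`.
  rcases eq_or_ne D ∞ with rfl | hDtop
  · rw [top_le_iff.1 hDK, ENNReal.top_rpow_of_pos (Real.logb_pos one_lt_two (by linarith)), mul_assoc,
      ENNReal.top_mul_top, ENNReal.mul_top]
    · exact le_top
    · refine (ENNReal.rpow_pos ?_ ENNReal.ofReal_ne_top).ne'
      simp
      linarith
  refine iSup_le_of_covers hS (by linarith) fun s hs n k a b hab hsub hlen hvol => ?_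
  refine (rhQuantity_le_of_lt_top hω hp hp' hab (left_lt_right_cell s n k) hsub hvol
    (mass_cell_le_mul_mass hω (hnest s hs) hDtop (hD s hs) hab hsub hlen)).trans ?_
  gcongr
  exact rhQuantity_cell_le (hK s hs) n k

theorem rhConst_top_le (hω : IsWeight ω)
    (hC : 1 ≤ C) (hS : Covers S C) (hnest : ∀ s ∈ S, Nested s) {D K : ℝ≥0∞}
    (hD : ∀ s ∈ S, dyadicDoublingConst (offsetGrid s) ω ≤ D) (hDK : D ≤ K)
    (hK : ∀ s ∈ S, rhDyadicConst (offsetGrid s) ∞ ω ≤ K) :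
    rhConst allIntervals ∞ ω ≤ D ^ Real.logb 2 (4 * C) * K := by
  rcases eq_or_ne D ∞ with rfl | hDtop
  · rw [top_le_iff.1 hDK, ENNReal.top_rpow_of_pos (Real.logb_pos one_lt_two (by linarith)),
      ENNReal.top_mul_top]
    exact le_top
  refine iSup_le_of_covers hS (by linarith) fun s hs n k a b hab hsub hlen hvol => ?_
  refine (rhQuantity_top_le hω hab (left_lt_right_cell s n k) hsub
    (mass_cell_le_mul_mass hω (hnest s hs) hDtop (hD s hs) hab hsub hlen)).trans ?_
  gcongr
  exact rhQuantity_cell_le (hK s hs) n k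

theorem rhConst_one_le (hω : IsWeight ω)
    (hC : 1 ≤ C) (hS : Covers S C) (hnest : ∀ s ∈ S, Nested s) {K : ℝ≥0}
    (hK : ∀ s ∈ S, rhDyadicConst (offsetGrid s) 1 ω ≤ K) :
    rhConst allIntervals 1 ω ≤
      (C.toNNReal * (K ^ Real.logb 2 (4 * C) * (K + 1) +
        K ^ Real.logb 2 (4 * C) * K ^ Real.logb 2 (4 * C)) : ℝ≥0) := by
  have hlog : 0 ≤ Real.logb 2 (4 * C) := Real.logb_nonneg one_lt_two (by linarith)
  refine iSup_le_of_covers hS (by linarith) fun s hs n k a b hab hsub hlen hvol => ?_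
  have hmass := mass_cell_le_mul_mass hω (hnest s hs) ENNReal.coe_ne_top
    ((le_max_right _ _).trans (hK s hs)) hab hsub hlen
  rw [← ENNReal.coe_rpow_of_nonneg _ hlog, ← ENNReal.ofReal_coe_nnreal] at hmass
  refine (rhQuantity_one_le hω hab (left_lt_right_cell s n k) NNReal.zero_le_coe hsub
    (le_of_eq_of_le (by ring) hlen) hmass (rhQuantity_cell_le (hK s hs) n k)).trans_eq ?_
  rw [← NNReal.coe_mul, ENNReal.ofReal_coe_nnreal, ENNReal.ofReal_coe_nnreal]
  rw [ENNReal.ofReal]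
  push_cast
  rfl

end Grids

/-! ### Reverse Hölder weights are doubling -/

/-- The part of a reverse Hölder weight above a large multiple of its average carries at most a
quarter of the mass. -/
theorem exists_tail_bound {p : ℝ≥0∞} (hp : 1 ≤ p) (K : ℝ≥0) :
    ∃ M : ℝ≥0, ∀ ω : ℝ → ℝ, IsWeight ω → ∀ a b : ℝ, a < b → rhQuantity p ω (Ico a b) ≤ K →
      ∫⁻ x in Ico a b, (ENNReal.ofReal (ω x) - M * avg ω (Ico a b)) ≤ mass ω (Ico a b) / 4 := by
  have trivial_case : ∀ (M : ℝ≥0) (ω : ℝ → ℝ), ∀ a b : ℝ, a < b →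
      avg ω (Ico a b) = 0 →
      ∫⁻ x in Ico a b, (ENNReal.ofReal (ω x) - M * avg ω (Ico a b)) ≤ mass ω (Ico a b) / 4 := by
    intro M ω a b hab h0
    calc _ ≤ mass ω (Ico a b) := lintegral_mono fun x => tsub_le_self
      _ = 0 := mass_eq_zero_of_avg_eq_zero hab h0
      _ ≤ _ := zero_le
  rcases hp.eq_or_lt with rfl | hp1
  -- Above this multiple of the average `A`, the logarithm of `ω / A` is at least `4 (K + 1)`, while
  -- the entropy is at most `(K + 1) |Q|`.
  · refine ⟨(Real.exp (4 * (K + 1))).toNNReal, fun ω hω a b hab hK => ?_⟩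
    rcases eq_or_ne (avg ω (Ico a b)) 0 with h0 | h0
    · exact trivial_case _ _ _ _ hab h0
    have hm : AEMeasurable ω (volume.restrict (Ico a b)) := hω.aemeasurable.restrict
    have ht := hω.avg_Ico_ne_top hab
    have hent := (rhQuantity_one hω hab).2
    rw [← avg_mul_volume ω hab]
    rw [entropy] at hent
    have hA : 0 < (avg ω (Ico a b)).toReal := ENNReal.toReal_pos h0 ht
    rw [← ENNReal.ofReal_toReal ht]
    set A := (avg ω (Ico a b)).toReal
    have hpt : ∀ x, ENNReal.ofReal (ω x) - ((Real.exp (4 * (K + 1))).toNNReal : ℝ≥0∞) *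
        ENNReal.ofReal A ≤ ENNReal.ofReal (A / (4 * (K + 1))) *
          ENNReal.ofReal (ω x / A * Real.log (ω x / A)) := by
      intro x
      rcases le_or_gt (ω x / A) (Real.exp (4 * (K + 1))) with h | h
      · rw [div_le_iff₀ hA] at h
        rw [tsub_eq_zero_of_le]
        · exact zero_le
        · change _ ≤ ENNReal.ofReal _ * _
          rw [← ENNReal.ofReal_mul (by positivity)]
          exact ENNReal.ofReal_le_ofReal h
      · refine tsub_le_self.trans ?_
        rw [← ENNReal.ofReal_mul (by positivity)]
        apply ENNReal.ofReal_le_ofReal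
        have hu : 0 < ω x / A := (Real.exp_pos _).trans h
        have hl : 4 * ((K : ℝ) + 1) ≤ Real.log (ω x / A) := (Real.le_log_iff_exp_le hu).2 h.le
        calc ω x = A / (4 * (K + 1)) * (ω x / A * (4 * (K + 1))) := by field_simp
          _ ≤ _ := by gcongr
    calc _ ≤ ENNReal.ofReal (A / (4 * (K + 1))) *
          ∫⁻ x in Ico a b, ENNReal.ofReal (ω x / A * Real.log (ω x / A)) := by
          rw [← lintegral_const_mul'' _ (by fun_prop)]
          exact lintegral_mono hpt
      _ ≤ ENNReal.ofReal (A / (4 * (K + 1))) * (ENNReal.ofReal (b - a) * (K + 1)) := by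
          gcongr
          exact hent.trans (by gcongr)
      _ = _ := by
        have e1 : (K : ℝ≥0∞) + 1 = ENNReal.ofReal (K + 1) := by
          rw [ENNReal.ofReal_add (by positivity) zero_le_one, ENNReal.ofReal_coe_nnreal,
            ENNReal.ofReal_one]
        have e2 : (4 : ℝ≥0∞) = ENNReal.ofReal 4 := by simp
        rw [Real.volume_Ico, e1, e2, ← ENNReal.ofReal_mul' (by positivity),
          ← ENNReal.ofReal_mul (by positivity), ← ENNReal.ofReal_mul (by positivity),
          ← ENNReal.ofReal_div_of_pos (by norm_num)]
        congr 1
        field_simp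
  rcases eq_or_ne p ∞ with rfl | hpt
  · refine ⟨K, fun ω hω a b hab hK => ?_⟩
    rcases eq_or_ne (avg ω (Ico a b)) 0 with h0 | h0
    · exact trivial_case _ _ _ _ hab h0
    rw [rhQuantity_top, ← div_eq_mul_inv,
      ENNReal.div_le_iff h0 (hω.avg_Ico_ne_top hab)] at hK
    rw [lintegral_congr_ae (g := 0), Pi.zero_def, lintegral_zero]
    · exact zero_le
    · filter_upwards [ENNReal.ae_le_essSup (fun x => ENNReal.ofReal (ω x))] with x hx
      exact tsub_eq_zero_of_le (hx.trans hK)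
  have hpr : 1 < p.toReal := by
    rw [← ENNReal.toReal_one]
    exact (ENNReal.toReal_lt_toReal (by simp) hpt).2 hp1
  have hp0 : 0 < p.toReal := by linarith
  have hq : 0 < p.toReal - 1 := by linarith
  -- Where `ω ≥ M A`, also `ω ^ p ≥ (M A) ^ (p - 1) ω`. The value of `M` makes `(M A) ^ (p - 1) = 4
  -- T`, with `T A |Q|` bounding the integral of `ω ^ p`; `K + 1` in place of `K` keeps `T` nonzero.
  refine ⟨(4 * (K + 1) ^ p.toReal) ^ (1 / (p.toReal - 1)), fun ω hω a b hab hK => ?_⟩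
  rcases eq_or_ne (avg ω (Ico a b)) 0 with h0 | h0
  · exact trivial_case _ _ _ _ hab h0
  have ht := hω.avg_Ico_ne_top hab
  have hm : AEMeasurable ω (volume.restrict (Ico a b)) := hω.aemeasurable.restrict
  rw [rhQuantity_of_lt_top hp1 hpt.lt_top, ← div_eq_mul_inv, ENNReal.div_le_iff h0 ht, nonnegAvg,
    one_div, ENNReal.rpow_inv_le_iff hp0,
    ENNReal.div_le_iff (volume_Ico_ne_zero hab) (volume_Ico_ne_top _ _)] at hK
  rw [← avg_mul_volume ω hab]
  lift avg ω (Ico a b) to ℝ≥0 using ht with A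
  have hA : A ≠ 0 := by simpa using h0
  set M : ℝ≥0 := (4 * (K + 1) ^ p.toReal) ^ (1 / (p.toReal - 1))
  set T : ℝ≥0 := (K + 1) ^ p.toReal * A ^ (p.toReal - 1)
  have hT : T ≠ 0 := by positivity
  have hMT : ((M * A : ℝ≥0) : ℝ≥0∞) ^ (p.toReal - 1) = (4 * T : ℝ≥0) := by
    rw [← ENNReal.coe_rpow_of_nonneg _ hq.le, NNReal.mul_rpow, ← NNReal.rpow_mul,
      one_div_mul_cancel hq.ne', NNReal.rpow_one, mul_assoc]
  have hKT : ((K : ℝ≥0∞) * A) ^ p.toReal ≤ T * A := by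
    rw [← ENNReal.coe_mul, ← ENNReal.coe_mul, ← ENNReal.coe_rpow_of_nonneg _ hp0.le,
      ENNReal.coe_le_coe, mul_assoc]
    nth_rw 3 [← NNReal.rpow_one A]
    rw [← NNReal.rpow_add hA, sub_add_cancel, NNReal.mul_rpow]
    gcongr
    exact le_self_add
  have hpt : ∀ x, ((4 * T : ℝ≥0) : ℝ≥0∞) * (ENNReal.ofReal (ω x) - M * A) ≤
      ENNReal.ofReal (ω x) ^ p.toReal := by
    intro x
    rcases le_total (ENNReal.ofReal (ω x)) (M * A) with h | h
    · rw [tsub_eq_zero_of_le h, mul_zero]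
      exact zero_le
    · rcases eq_or_ne (ENNReal.ofReal (ω x)) 0 with h1 | h1
      · rw [h1, zero_tsub, mul_zero]
        exact zero_le
      calc _ ≤ ENNReal.ofReal (ω x) ^ (p.toReal - 1) * ENNReal.ofReal (ω x) := by
            rw [← hMT, ENNReal.coe_mul]
            gcongr
            exact tsub_le_self
        _ = _ := by
            nth_rw 2 [← ENNReal.rpow_one (ENNReal.ofReal (ω x))]
            rw [← ENNReal.rpow_add _ _ h1 ENNReal.ofReal_ne_top, sub_add_cancel]
  rw [ENNReal.le_div_iff_mul_le (by simp) (by simp),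
    ← ENNReal.mul_le_mul_iff_right (a := (T : ℝ≥0∞)) (by simpa using hT) ENNReal.coe_ne_top]
  calc _ = ∫⁻ x in Ico a b, ((4 * T : ℝ≥0) : ℝ≥0∞) * (ENNReal.ofReal (ω x) - M * A) := by
        rw [lintegral_const_mul'' _ (by fun_prop)]
        push_cast
        ring
    _ ≤ ∫⁻ x in Ico a b, ENNReal.ofReal (ω x) ^ p.toReal := lintegral_mono hpt
    _ ≤ _ := hK
    _ ≤ _ := by
        rw [← mul_assoc]
        gcongr

/-- Cut `ω` at height `M` times its average. The part below contributes at most a quarter of the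
mass on a set of relative measure `1 / (4 (M + 1))`, and the tail at most another quarter. -/
theorem exists_small_set_bound {p : ℝ≥0∞} (hp : 1 ≤ p) (K : ℝ≥0) :
    ∃ ε : ℝ, 0 < ε ∧ ∀ ω : ℝ → ℝ, IsWeight ω → ∀ a b : ℝ, a < b →
      rhQuantity p ω (Ico a b) ≤ K → ∀ E ⊆ Ico a b, volume E ≤ ENNReal.ofReal (ε * (b - a)) →
        mass ω E ≤ mass ω (Ico a b) / 2 := by
  obtain ⟨M, hM⟩ := exists_tail_bound hp K
  refine ⟨1 / (4 * (M + 1)), by positivity, fun ω hω a b hab hK E hE hvol => ?_⟩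
  have hba : 0 < b - a := sub_pos.2 hab
  calc mass ω E ≤ ∫⁻ x in E, (M * avg ω (Ico a b) +
        (ENNReal.ofReal (ω x) - M * avg ω (Ico a b))) := lintegral_mono fun x => le_add_tsub
    _ = M * avg ω (Ico a b) * volume E +
        ∫⁻ x in E, (ENNReal.ofReal (ω x) - M * avg ω (Ico a b)) := by
        rw [lintegral_add_left measurable_const, setLIntegral_const]
    _ ≤ mass ω (Ico a b) / 4 + mass ω (Ico a b) / 4 := by
        gcongr
        · calc _ ≤ M * avg ω (Ico a b) * (ENNReal.ofReal (b - a) / (4 * (M + 1))) := by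
                gcongr
                refine hvol.trans_eq ?_
                rw [one_div, mul_comm, ← div_eq_mul_inv, ENNReal.ofReal_div_of_pos (by positivity),
                  ENNReal.ofReal_mul (by positivity),
                  ENNReal.ofReal_add (by positivity) (by positivity), ENNReal.ofReal_coe_nnreal]
                simp
            _ = M / (M + 1) * (avg ω (Ico a b) * ENNReal.ofReal (b - a) / 4) := by
                simp only [div_eq_mul_inv]
                rw [ENNReal.mul_inv (by simp) (by simp)]
                ring
            _ ≤ 1 * (avg ω (Ico a b) * ENNReal.ofReal (b - a) / 4) := by
                gcongr
                exact ENNReal.div_le_of_le_mul (by simp)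
            _ = _ := by rw [one_mul, ← Real.volume_Ico, avg_mul_volume ω hab]
        · exact (lintegral_mono_set hE).trans (hM ω hω a b hab hK)
    _ = _ := by
        rw [← two_mul, ← mul_div_assoc, show (4 : ℝ≥0∞) = 2 * 2 by norm_num,
          ENNReal.mul_div_mul_left _ _ (by simp) (by simp)]

/-- In a concentric enlargement by `1 + ε` the added shell has relative measure at most `ε`, hence
at most half of the enlarged mass, so the mass at most doubles. `N` such steps with `(1 + ε) ^ N >
2` cover the doubled interval. -/
theorem exists_doublingConst_bound {p : ℝ≥0∞} (hp : 1 ≤ p) (K : ℝ≥0) :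
    ∃ B : ℝ≥0, ∀ ω : ℝ → ℝ, IsWeight ω → rhConst allIntervals p ω ≤ K → doublingConst ω ≤ B := by
  obtain ⟨ε, hε, h⟩ := exists_small_set_bound hp K
  obtain ⟨N, hN⟩ := pow_unbounded_of_one_lt 2 (show 1 < 1 + ε by linarith)
  refine ⟨2 ^ N, fun ω hω hK => sInf_le fun a b hab => ?_⟩
  set c := (a + b) / 2
  set r := (b - a) / 2
  have hr : 0 < r := by simp only [r]; linarith
  have step : ∀ ρ : ℝ, 0 < ρ → mass ω (Ico (c - (1 + ε) * ρ) (c + (1 + ε) * ρ)) ≤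
      2 * mass ω (Ico (c - ρ) (c + ρ)) := by
    intro ρ hρ
    have hερ : 0 < ε * ρ := by positivity
    set Q := Ico (c - ρ) (c + ρ)
    set R := Ico (c - (1 + ε) * ρ) (c + (1 + ε) * ρ)
    have hlt : c - (1 + ε) * ρ < c + (1 + ε) * ρ := by linarith
    have hQR : Q ⊆ R := Ico_subset_Ico (by linarith) (by linarith)
    have hdiff : mass ω (R \ Q) ≤ mass ω R / 2 := by
      refine h ω hω _ _ hlt
        ((le_iSup₂ (f := fun Q _ => rhQuantity p ω Q) _ ⟨_, _, hlt, rfl⟩).trans hK) _ sdiff_subset ?_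
      rw [measure_sdiff hQR nullMeasurableSet_Ico (volume_Ico_ne_top _ _), Real.volume_Ico,
        Real.volume_Ico, ← ENNReal.ofReal_sub _ (by linarith)]
      apply ENNReal.ofReal_le_ofReal
      nlinarith [mul_pos hε hερ]
    have hle : mass ω R ≤ mass ω Q + mass ω R / 2 := by
      calc mass ω R = mass ω (Q ∪ R \ Q) := by rw [union_sdiff_cancel hQR]
        _ ≤ mass ω Q + mass ω (R \ Q) := lintegral_union_le _ _ _
        _ ≤ _ := by gcongr
    have hfin : mass ω R / 2 ≠ ∞ := ENNReal.div_ne_top (hω.mass_Ico_ne_top _ _) (by simp)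
    nth_rw 1 [← ENNReal.add_halves (mass ω R)] at hle
    have hle' := (ENNReal.add_le_add_iff_right hfin).1 hle
    rw [mul_comm]
    exact (ENNReal.div_le_iff (by simp) (by simp)).1 hle'
  have iter : ∀ m : ℕ, mass ω (Ico (c - (1 + ε) ^ m * r) (c + (1 + ε) ^ m * r)) ≤
      2 ^ m * mass ω (Ico (c - r) (c + r)) := by
    intro m
    induction m with
    | zero => simp
    | succ m ih =>
      rw [pow_succ', mul_assoc, pow_succ', mul_assoc]
      exact (step _ (by positivity)).trans (by gcongr)
  have e : Ico (c - r) (c + r) = Ico a b := by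
    congr 1 <;> simp only [c, r] <;> ring
  have := iter N
  rw [e] at this
  push_cast
  refine (mass_mono ω (Ico_subset_Ico ?_ ?_)).trans this
  · have : 2 * r ≤ (1 + ε) ^ N * r := by gcongr
    simp only [c, r] at this ⊢
    linarith
  · have : 2 * r ≤ (1 + ε) ^ N * r := by gcongr
    simp only [c, r] at this ⊢
    linarith

/-! ### Dependence of constants -/

/-- The equalities of classes follow from the quantitative statements through this equivalence. -/
theorem DependOnlyOnEachOther.lt_top_iff {c c₁ c₂ : (ℝ → ℝ) → ℝ≥0∞}
    (h : DependOnlyOnEachOther c c₁ c₂) {ω : ℝ → ℝ} (hω : IsWeight ω) :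
    c ω < ∞ ↔ c₁ ω < ∞ ∧ c₂ ω < ∞ := by
  obtain ⟨⟨Φ, hΦ⟩, Ψ, hΨ⟩ := h
  constructor
  · intro hc
    have := hΨ ω hω (c ω).toNNReal (ENNReal.coe_toNNReal hc.ne).ge
    exact ⟨this.1.trans_lt ENNReal.coe_lt_top, this.2.trans_lt ENNReal.coe_lt_top⟩
  · rintro ⟨h1, h2⟩
    exact (hΦ ω hω _ _ (ENNReal.coe_toNNReal h1.ne).ge (ENNReal.coe_toNNReal h2.ne).ge).trans_lt
      ENNReal.coe_lt_top

section

variable {s₁ s₂ : ℤ → ℝ} {C : ℝ}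

theorem dependOnlyOnEachOther_doublingConst (hC : 1 ≤ C) (hS : Covers {s₁, s₂} C)
    (hnest : ∀ s ∈ ({s₁, s₂} : Set (ℤ → ℝ)), Nested s) :
    DependOnlyOnEachOther doublingConst
      (dyadicDoublingConst (offsetGrid s₁)) (dyadicDoublingConst (offsetGrid s₂)) := by
  refine ⟨⟨fun K₁ K₂ => max K₁ K₂ ^ Real.logb 2 (2 ^ 3 * C), fun ω hω K₁ K₂ h₁ h₂ => ?_⟩,
    fun K => K ^ 2, fun ω hω K hK => ⟨?_, ?_⟩⟩
  · rw [ENNReal.coe_rpow_of_nonneg _ (Real.logb_nonneg one_lt_two (by linarith))]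
    refine doublingConst_le hω hC hS hnest ?_
    rintro s (rfl | rfl)
    · exact h₁.trans (ENNReal.coe_le_coe.2 (le_max_left _ _))
    · exact h₂.trans (ENNReal.coe_le_coe.2 (le_max_right _ _))
  · exact dyadicDoublingConst_le_sq hω _ hK
  · exact dyadicDoublingConst_le_sq hω _ hK

theorem dependOnlyOnEachOther_apConst (hC : 1 ≤ C) (hS : Covers {s₁, s₂} C) {p : ℝ≥0∞}
    (hp : 1 ≤ p) :
    DependOnlyOnEachOther (apConst allIntervals p)
      (apConst (gridIntervals (offsetGrid s₁)) p) (apConst (gridIntervals (offsetGrid s₂)) p) := by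
  refine ⟨?_, id, fun ω _ K hK => ⟨?_, ?_⟩⟩
  · rcases eq_or_ne p ∞ with rfl | hp'
    · refine ⟨fun K₁ K₂ =>
        (C * Real.exp (C * (Real.log ((max K₁ K₂ : ℝ≥0) : ℝ) + 1))).toNNReal,
        fun ω hω K₁ K₂ h₁ h₂ => apConst_top_le hω hC hS ?_⟩
      rintro s (rfl | rfl) <;> rw [ENNReal.ofReal_coe_nnreal]
      · exact h₁.trans (ENNReal.coe_le_coe.2 (le_max_left _ _))
      · exact h₂.trans (ENNReal.coe_le_coe.2 (le_max_right _ _))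
    · refine ⟨fun K₁ K₂ => C.toNNReal ^ p.toReal * max K₁ K₂, fun ω hω K₁ K₂ h₁ h₂ => ?_⟩
      rw [ENNReal.coe_mul, ENNReal.coe_rpow_of_nonneg _ ENNReal.toReal_nonneg]
      refine apConst_le_of_lt_top ω hp hp'.lt_top hC hS ?_
      rintro s (rfl | rfl)
      · exact h₁.trans (ENNReal.coe_le_coe.2 (le_max_left _ _))
      · exact h₂.trans (ENNReal.coe_le_coe.2 (le_max_right _ _))
  · exact (biSup_mono fun _ h => gridIntervals_offsetGrid_subset _ h).trans hK
  · exact (biSup_mono fun _ h => gridIntervals_offsetGrid_subset _ h).trans hK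

theorem dependOnlyOnEachOther_rhConst (hC : 1 ≤ C) (hS : Covers {s₁, s₂} C)
    (hnest : ∀ s ∈ ({s₁, s₂} : Set (ℤ → ℝ)), Nested s) {p : ℝ≥0∞} (hp : 1 ≤ p) :
    DependOnlyOnEachOther (rhConst allIntervals p)
      (rhDyadicConst (offsetGrid s₁) p) (rhDyadicConst (offsetGrid s₂) p) := by
  constructor
  · have hmax : ∀ {ω : ℝ → ℝ} {K₁ K₂ : ℝ≥0}, rhDyadicConst (offsetGrid s₁) p ω ≤ K₁ →
        rhDyadicConst (offsetGrid s₂) p ω ≤ K₂ →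
        ∀ s ∈ ({s₁, s₂} : Set (ℤ → ℝ)), rhDyadicConst (offsetGrid s) p ω ≤ (max K₁ K₂ : ℝ≥0) := by
      rintro ω K₁ K₂ h₁ h₂ s (rfl | rfl)
      · exact h₁.trans (ENNReal.coe_le_coe.2 (le_max_left _ _))
      · exact h₂.trans (ENNReal.coe_le_coe.2 (le_max_right _ _))
    have hlog : 0 ≤ Real.logb 2 (4 * C) := Real.logb_nonneg one_lt_two (by linarith)
    rcases hp.eq_or_lt with rfl | hp1
    · exact ⟨_, fun ω hω K₁ K₂ h₁ h₂ => rhConst_one_le hω hC hS hnest (hmax h₁ h₂)⟩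
    rcases eq_or_ne p ∞ with rfl | hp'
    · refine ⟨fun K₁ K₂ => max K₁ K₂ ^ Real.logb 2 (4 * C) * max K₁ K₂,
        fun ω hω K₁ K₂ h₁ h₂ => ?_⟩
      rw [ENNReal.coe_mul, ENNReal.coe_rpow_of_nonneg _ hlog]
      exact rhConst_top_le hω hC hS hnest
        (fun s hs => (le_max_right _ _).trans (hmax h₁ h₂ s hs)) le_rfl (hmax h₁ h₂)
    · refine ⟨fun K₁ K₂ => C.toNNReal ^ (1 / p.toReal) *
        max K₁ K₂ ^ Real.logb 2 (4 * C) * max K₁ K₂, fun ω hω K₁ K₂ h₁ h₂ => ?_⟩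
      rw [ENNReal.coe_mul, ENNReal.coe_mul, ENNReal.coe_rpow_of_nonneg _ hlog,
        ENNReal.coe_rpow_of_nonneg _ (by positivity)]
      exact rhConst_le_of_lt_top hω hp1 hp'.lt_top hC hS hnest
        (fun s hs => (le_max_right _ _).trans (hmax h₁ h₂ s hs)) le_rfl (hmax h₁ h₂)
  -- The dyadic constant includes the dyadic doubling constant, which is bounded by passing from
  -- `RH_p` to doubling.
  · choose B hB using exists_doublingConst_bound hp
    have key : ∀ (s : ℤ → ℝ) (ω : ℝ → ℝ), IsWeight ω → ∀ K : ℝ≥0, rhConst allIntervals p ω ≤ K →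
        rhDyadicConst (offsetGrid s) p ω ≤ (max K (B K ^ 2) : ℝ≥0) := by
      intro s ω hω K hK
      rw [ENNReal.coe_max]
      exact max_le_max ((biSup_mono fun _ h => gridIntervals_offsetGrid_subset s h).trans hK)
        (dyadicDoublingConst_le_sq hω s (hB K ω hω hK))
    exact ⟨_, fun ω hω K hK => ⟨key _ ω hω K hK, key _ ω hω K hK⟩⟩

end

end DyadicWeights

theorem mainTheorem1 (δ : ℝ) (hδ : 0 < relDist δ) :
    -- equality of the classes
    (∀ ω : ℝ → ℝ, IsDoubling ω ↔
      IsDyadicDoubling dyadicGrid ω ∧ IsDyadicDoubling (shiftedGrid δ) ω) ∧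
    (∀ p : ℝ≥0∞, 1 ≤ p →
      apClass allIntervals p =
        apClass (gridIntervals dyadicGrid) p ∩ apClass (gridIntervals (shiftedGrid δ)) p) ∧
    (∀ p : ℝ≥0∞, 1 ≤ p →
      rhClass p = rhDyadicClass dyadicGrid p ∩ rhDyadicClass (shiftedGrid δ) p) ∧
    -- the continuous constants depend only on the two dyadic ones, and vice versa
    DependOnlyOnEachOther doublingConst
      (dyadicDoublingConst dyadicGrid) (dyadicDoublingConst (shiftedGrid δ)) ∧
    (∀ p : ℝ≥0∞, 1 ≤ p → DependOnlyOnEachOther (apConst allIntervals p)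
      (apConst (gridIntervals dyadicGrid) p) (apConst (gridIntervals (shiftedGrid δ)) p)) ∧
    (∀ p : ℝ≥0∞, 1 ≤ p → DependOnlyOnEachOther (rhConst allIntervals p)
      (rhDyadicConst dyadicGrid p) (rhDyadicConst (shiftedGrid δ) p)) ∧
    -- explicit bounds, with one constant `C` that depends only on `δ`
    (∃ C : ℝ, 1 ≤ C ∧ ∀ ω : ℝ → ℝ, IsWeight ω →
      doublingConst ω ≤
        (max (dyadicDoublingConst dyadicGrid ω) (dyadicDoublingConst (shiftedGrid δ) ω)) ^
          Real.logb 2 (2 ^ 3 * C) ∧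
      (∀ p : ℝ≥0∞, 1 ≤ p → p < ∞ →
        apConst allIntervals p ω ≤
          ENNReal.ofReal C ^ p.toReal *
            max (apConst (gridIntervals dyadicGrid) p ω)
              (apConst (gridIntervals (shiftedGrid δ)) p ω)) ∧
      (∀ p : ℝ≥0∞, 1 < p → p < ∞ →
        rhConst allIntervals p ω ≤
          ENNReal.ofReal C ^ (1 / p.toReal) *
            (max (dyadicDoublingConst dyadicGrid ω) (dyadicDoublingConst (shiftedGrid δ) ω)) ^
              Real.logb 2 (4 * C) *
            max (rhDyadicConst dyadicGrid p ω) (rhDyadicConst (shiftedGrid δ) p ω)) ∧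
      rhConst allIntervals ∞ ω ≤
        (max (dyadicDoublingConst dyadicGrid ω) (dyadicDoublingConst (shiftedGrid δ) ω)) ^
          Real.logb 2 (4 * C) *
        max (rhDyadicConst dyadicGrid ∞ ω) (rhDyadicConst (shiftedGrid δ) ∞ ω)) := by
  obtain ⟨C, hC, hcov⟩ := exists_cover hδ
  rw [dyadicGrid_eq, shiftedGrid_eq]
  set s₁ : ℤ → ℝ := fun _ => 0
  set s₂ : ℤ → ℝ := fun n => δ + largeScaleShift n
  have hS : Covers {s₁, s₂} C := fun a b hab => by
    obtain ⟨s, n, k, hs, h⟩ := hcov a b hab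
    exact ⟨s, hs, n, k, h⟩
  have hnest : ∀ s ∈ ({s₁, s₂} : Set (ℤ → ℝ)), Nested s := by
    rintro s (rfl | rfl)
    · exact nested_zero
    · exact nested_shift δ
  have hmax : ∀ {F : (ℤ → ℝ) → ℝ≥0∞}, ∀ s ∈ ({s₁, s₂} : Set (ℤ → ℝ)), F s ≤ max (F s₁) (F s₂) := by
    rintro F s (rfl | rfl)
    · exact le_max_left _ _
    · exact le_max_right _ _
  have hd := dependOnlyOnEachOther_doublingConst hC hS hnest
  have hap : ∀ p : ℝ≥0∞, 1 ≤ p → _ := fun p hp => dependOnlyOnEachOther_apConst hC hS hp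
  have hrh : ∀ p : ℝ≥0∞, 1 ≤ p → _ := fun p hp => dependOnlyOnEachOther_rhConst hC hS hnest hp
  have hDK : ∀ (p : ℝ≥0∞) (ω : ℝ → ℝ),
      max (dyadicDoublingConst (offsetGrid s₁) ω) (dyadicDoublingConst (offsetGrid s₂) ω) ≤
        max (rhDyadicConst (offsetGrid s₁) p ω) (rhDyadicConst (offsetGrid s₂) p ω) :=
    fun p ω => max_le_max (le_max_right _ _) (le_max_right _ _)
  refine ⟨fun ω => ?_, fun p hp => ?_, fun p hp => ?_, hd, hap, hrh, C, hC, fun ω hω =>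
    ⟨doublingConst_le hω hC hS hnest (hmax (F := fun s => dyadicDoublingConst (offsetGrid s) ω)),
      fun p hp hp' => apConst_le_of_lt_top ω hp hp' hC hS
        (hmax (F := fun s => apConst (gridIntervals (offsetGrid s)) p ω)),
      fun p hp hp' => rhConst_le_of_lt_top hω hp hp' hC hS hnest
        (hmax (F := fun s => dyadicDoublingConst (offsetGrid s) ω)) (hDK p ω)
        (hmax (F := fun s => rhDyadicConst (offsetGrid s) p ω)),
      rhConst_top_le hω hC hS hnest
        (hmax (F := fun s => dyadicDoublingConst (offsetGrid s) ω)) (hDK ∞ ω)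
        (hmax (F := fun s => rhDyadicConst (offsetGrid s) ∞ ω))⟩⟩
  · by_cases hω : IsWeight ω
    · simp only [IsDoubling, IsDyadicDoubling, hω, true_and]
      exact hd.lt_top_iff hω
    · simp [IsDoubling, IsDyadicDoubling, hω]
  · ext ω
    by_cases hω : IsWeight ω
    · simp only [apClass, mem_inter_iff, mem_ofPred_eq, hω, true_and]
      exact (hap p hp).lt_top_iff hω
    · simp [apClass, hω]
  · ext ω
    by_cases hω : IsWeight ω
    · simp only [rhClass, rhDyadicClass, IsDyadicDoubling, mem_inter_iff, mem_ofPred_eq, hω,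
        true_and]
      rw [(hrh p hp).lt_top_iff hω, rhDyadicConst, rhDyadicConst, max_lt_iff, max_lt_iff]
    · simp [rhClass, rhDyadicClass, hω]
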